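/- Let $X$ be a countable set with a measure $m$ on all its subsets such that $0<m(x):=m(\{x\})<\infty$ for all $x\in X$, and let $(b,c)$ be a graph over $(X,m)$: $b\colon X\times X\to[0,\infty)$ is symmetric, vanishes on the diagonal, $\sum_y b(x,y)<\infty$ for all $x$, and $c\colon X\to[0,\infty)$. Put $$\mathcal Q(f,g)=\tfrac12\sum_{x,y}b(x,y)(f(x)-f(y))(g(x)-g(y))+\sum_x c(x)f(x)g(x),\qquad \mathcal Q(f)=\mathcal Q(f,f)\in[0,\infty],$$ $$\mathcal Lf(x)=\tfrac1{m(x)}\sum_y b(x,y)(f(x)-f(y))+\tfrac{c(x)}{m(x)}f(x).$$ Let $Q^{(N)}$ be the restriction of $\mathcal Q$ to $D(Q^{(N)})=\{f\in\ell^2(X,m)\mid\mathcal Q(f)<\infty\}$, and $Q^{(D)}$ its restriction to the closure $D(Q^{(D)})$ of the finitely supported functions with respect to the form norm $(\mathcal Q(f)+\|f\|^2)^{1/2}$. Let $L^{(N)}$, $L^{(D)}$ be the associated self-adjoint operators on $\ell^2(X,m)$. Let $\hat X$ be the compact Hausdorff space, unique up to homeomorphism, that contains $X$ as a dense subset consisting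 of open points and to which all bounded $f\in D(Q^{(N)})$ extend continuously, the extensions separating the points of $\hat X$. Every $f\in D(Q^{(N)})$ extends uniquely to a continuous function $\hat X\to[-\infty,\infty]$, again denoted by $f$. The $1$-harmonic boundary is $$\partial X=\{z\in\hat X\setminus X\mid f(z)=0\text{ for all bounded }f\in D(Q^{(D)})\}.$$ A $1$-harmonic measure is a Radon measure $\mu=\mu_o$ on $\partial X$, for some $o\in X$, with $\mu(\partial X)\le1$ and $h(o)=\int_{\partial X}f\,d\mu$ whenever $f\in D(Q^{(N)})$ is bounded and $h\in D(Q^{(N)})$ satisfies $\mathcal Lh+h=0$ on $X$ and $h=f$ on $\partial X$; if $1\notin D(Q^{(N)})$, it is also required that $\mu(\{\infty\})=0$ for the point $\infty\in\partial X$ at which all bounded functions in $D(Q^{(N)})$ vanish. Fix a $1$-harmonic measure $\mu$. For $f\in D(Q^{(N)})$ with $\mathcal Lf\in\ell^2(X,m)$ let $\partial_nf(g)=Q^{(N)}(f,g)-\langle\mathcal Lf,g\rangle$ for $g\in D(Q^{(N)})$. If there is $\varphi\in L^2(\partial X,\mu)$ with $\int_{\partial X}\varphi g\,d\mu=\partial_nf(g)$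 for all $g\in D(Q^{(N)})$, write $f\in D(\partial_{n,\mu})$ and $\partial_{n,\mu}f=\varphi$. For a measurable $\beta\colon\partial X\to[0,\infty]$ let $F_\beta$ be the support of the measure $1_{\{\beta=\infty\}}\mu$, and define (with $\infty\cdot0=0$) $$D(Q^\beta)=\Big\{f\in D(Q^{(N)})\,\Big|\,\int_{\partial X}|f|^2\beta\,d\mu<\infty\Big\},\qquad Q^\beta(f)=Q^{(N)}(f)+\int_{\partial X}|f|^2\beta\,d\mu.$$ Let $L^\beta$ be the restriction of $\mathcal L$ to the set $D(L^\beta)$ of all $f\in D(Q^{(N)})$ with $\mathcal Lf\in\ell^2(X,m)$, $\int_{\partial X}|f|^2\beta\,d\mu<\infty$, $f=0$ on $F_\beta$, and $$\partial_nf(g)+\int_{\partial X}fg\,\beta\,d\mu=0\quad\text{for all }g\in D(Q^{(N)})\text{ with }\int_{\partial X}|g|^2\beta\,d\mu<\infty\text{ and }g=0\text{ on }F_\beta.$$ **Theorem.** For every measurable $\beta\colon\partial X\to[0,\infty]$ the form $Q^\beta$ is a Dirichlet form, and $L^\beta$ is the self-adjoint operator of $Q^\beta$. In particular, $Q^{(N)}=Q^0$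 and, if the graph is connected, $Q^{(D)}=Q^\infty$ (the form $Q^\beta$ for $\beta\equiv\infty$). Moreover, $L^{(D)}$ and $L^{(N)}$ are the restrictions of $\mathcal L$ to $$D(L^{(D)})=\{f\in D(Q^{(N)})\mid\mathcal Lf\in\ell^2(X,m),\ f=0\text{ on }\partial X\},$$ $$D(L^{(N)})=\{f\in D(Q^{(N)})\mid\mathcal Lf\in\ell^2(X,m),\ \partial_nf=0\}=\ker\partial_{n,\mu}.$$ -/

import Mathlib

open MeasureTheory Set Filter Topology
open scoped ENNReal

noncomputable section

/-! ## Forms and operators on a Hilbert space -/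

/-- The data of a form on `H`: a domain and a real-valued function of two variables.  The values
`val f g` have a meaning only for `f, g` in the domain; the laws are in `HForm.IsForm`. -/
structure HForm (H : Type*) where
  dom : Set H
  val : H → H → ℝ

namespace HForm

section Hilbert

variable {H : Type*} [NormedAddCommGroup H] [InnerProductSpace ℝ H]

/-- Two forms are equal: same domain, and same values on the domain. -/
def Same (Q Q' : HForm H) : Prop :=
  Q.dom = Q'.dom ∧ ∀ f ∈ Q.dom, ∀ g ∈ Q.dom, Q.val f g = Q'.val f g

/-- `Q` is a symmetric positive form: its domain is a linear subspace, on which `Q` is symmetric,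
bilinear and positive. -/
structure IsForm (Q : HForm H) : Prop where
  zero_mem : (0 : H) ∈ Q.dom
  add_mem : ∀ f ∈ Q.dom, ∀ g ∈ Q.dom, f + g ∈ Q.dom
  smul_mem : ∀ (a : ℝ), ∀ f ∈ Q.dom, a • f ∈ Q.dom
  symm : ∀ f ∈ Q.dom, ∀ g ∈ Q.dom, Q.val f g = Q.val g f
  linear : ∀ f ∈ Q.dom, ∀ g ∈ Q.dom, ∀ h ∈ Q.dom, ∀ α β : ℝ,
    Q.val f (α • g + β • h) = α * Q.val f g + β * Q.val f h
  nonneg : ∀ f ∈ Q.dom, 0 ≤ Q.val f f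

/-- The square of the form norm, `Q₁(f) = Q(f) + ‖f‖²`. -/
def normSq (Q : HForm H) (f : H) : ℝ := Q.val f f + ‖f‖ ^ 2

/-- `Q` is closed: its domain is complete with respect to the form norm. -/
def Closed (Q : HForm H) : Prop :=
  ∀ u : ℕ → H, (∀ n, u n ∈ Q.dom) →
    (∀ ε : ℝ, 0 < ε → ∃ N, ∀ n ≥ N, ∀ k ≥ N, Q.normSq (u n - u k) < ε) →
    ∃ f ∈ Q.dom, Tendsto (fun n => Q.normSq (u n - f)) atTop (𝓝 0)

/-- `L` is the positive self-adjoint operator of the form `Q`: it is densely defined, self-adjoint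
and positive, with `D(L) ⊆ D(Q)` and `Q(f, g) = ⟨f, L g⟩` for `f ∈ D(Q)`, `g ∈ D(L)`. -/
structure IsOperatorOf [CompleteSpace H] (L : H →ₗ.[ℝ] H) (Q : HForm H) : Prop where
  dense : Dense (L.domain : Set H)
  selfAdjoint : IsSelfAdjoint L
  nonneg : ∀ g : L.domain, 0 ≤ inner ℝ (L g) (g : H)
  domain_subset : (L.domain : Set H) ⊆ Q.dom
  val_eq : ∀ f ∈ Q.dom, ∀ g : L.domain, Q.val f g = inner ℝ f (L g)

end Hilbert

/-- `Q` is a Dirichlet form on `L²(α, m)`: a closed, densely defined form that is compatible with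
all normal contractions. -/
structure IsDirichletForm {α : Type*} [MeasurableSpace α] {m : Measure α}
    (Q : HForm (Lp ℝ 2 m)) : Prop where
  isForm : Q.IsForm
  closed : Q.Closed
  dense : Dense Q.dom
  markov : ∀ (C : ℝ → ℝ) (hC : LipschitzWith 1 C) (hC0 : C 0 = 0), ∀ f ∈ Q.dom,
    hC.compLp hC0 f ∈ Q.dom ∧ Q.val (hC.compLp hC0 f) (hC.compLp hC0 f) ≤ Q.val f f

end HForm

/-! ## Graphs, energy and the formal Laplacian -/

/-- A (weighted) graph `(b, c)` over `X`. -/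
structure WGraph (X : Type*) where
  b : X → X → ℝ
  c : X → ℝ
  b_nonneg : ∀ x y, 0 ≤ b x y
  b_symm : ∀ x y, b x y = b y x
  b_self : ∀ x, b x x = 0
  b_summable : ∀ x, Summable (b x)
  c_nonneg : ∀ x, 0 ≤ c x

namespace WGraph

variable {X : Type*} (G : WGraph X)

/-- Any two vertices are joined by a finite path of edges. -/
def Connected : Prop := ∀ x y, Relation.ReflTransGen (fun u v => 0 < G.b u v) x y

/-- The energy `𝒬(f) ∈ [0, ∞]`. -/
def energy (f : X → ℝ) : ℝ≥0∞ :=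
  2⁻¹ * (∑' x, ∑' y, ENNReal.ofReal (G.b x y * (f x - f y) ^ 2))
    + ∑' x, ENNReal.ofReal (G.c x * f x ^ 2)

/-- The energy `𝒬(f, g)` for `f, g` of finite energy (both series then converge absolutely). -/
def energyBilin (f g : X → ℝ) : ℝ :=
  1 / 2 * (∑' p : X × X, G.b p.1 p.2 * (f p.1 - f p.2) * (g p.1 - g p.2))
    + ∑' x, G.c x * f x * g x

theorem energy_single_lt_top [DecidableEq X] (x : X) : G.energy (Pi.single x 1) < ∞ := by
  have hs : ∑' y, ENNReal.ofReal (G.b x y) < ∞ :=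
    (G.b_summable x).tsum_ofReal_lt_top
  refine ENNReal.add_lt_top.2 ⟨ENNReal.mul_lt_top (by simp) ?_, ?_⟩
  · have hle : ∀ u v, ENNReal.ofReal (G.b u v *
        ((Pi.single x 1 : X → ℝ) u - (Pi.single x 1 : X → ℝ) v) ^ 2) ≤
        (if u = x then ENNReal.ofReal (G.b x v) else 0) +
          (if v = x then ENNReal.ofReal (G.b x u) else 0) := by
      intro u v
      by_cases hu : u = x <;> by_cases hv : v = x
      · subst hu; subst hv; simp
      · subst hu; simp [hv]
      · subst hv; simp [hu, G.b_symm u v]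
      · simp [hu, hv]
    refine (ENNReal.tsum_le_tsum fun u => ENNReal.tsum_le_tsum fun v => hle u v).trans_lt ?_
    simp only [ENNReal.tsum_add]
    refine ENNReal.add_lt_top.2 ⟨?_, ?_⟩
    · rw [tsum_eq_single x (by intro u hu; simp [hu])]
      simpa using hs
    · simpa using hs
  · rw [tsum_eq_single x (by intro u hu; simp [hu])]
    simp

variable [MeasurableSpace X] (m : Measure X)

/-- The formal Laplacian (the series converges for `f` of finite energy). -/
def lap (f : X → ℝ) (x : X) : ℝ :=
  1 / m.real {x} * (∑' y, G.b x y * (f x - f y)) + G.c x / m.real {x} * f x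

/-- The Neumann form domain: functions in `ℓ²(X, m)` of finite energy. -/
def neumannDom : Set (X → ℝ) := {f | MemLp f 2 m ∧ G.energy f < ∞}

/-- The Dirichlet form domain: the closure of the finitely supported functions in the Neumann form
domain with respect to the form norm. -/
def dirichletDom : Set (X → ℝ) :=
  {f | f ∈ G.neumannDom m ∧ ∀ ε : ℝ≥0∞, 0 < ε → ∃ φ : X → ℝ, φ.support.Finite ∧
    G.energy (f - φ) + eLpNorm (f - φ) 2 m ^ 2 < ε}

/-- The form `Q^(N)` on `ℓ²(X, m)`. -/
def neumannForm : HForm (Lp ℝ 2 m) where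
  dom := {f | (f : X → ℝ) ∈ G.neumannDom m}
  val f g := G.energyBilin f g

/-- The form `Q^(D)` on `ℓ²(X, m)`. -/
def dirichletForm : HForm (Lp ℝ 2 m) where
  dom := {f | (f : X → ℝ) ∈ G.dirichletDom m}
  val f g := G.energyBilin f g

/-- The operator `L` on `ℓ²(X, m)` is the restriction of the formal Laplacian to `D`. -/
def IsLapRestriction (L : Lp ℝ 2 m →ₗ.[ℝ] Lp ℝ 2 m) (D : Set (X → ℝ)) : Prop :=
  (∀ f : Lp ℝ 2 m, f ∈ L.domain ↔ (f : X → ℝ) ∈ D) ∧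
    ∀ f : L.domain, ∀ x, (L f : Lp ℝ 2 m) x = G.lap m ((f : Lp ℝ 2 m) : X → ℝ) x

/-! ## The compactification, the boundary and the trace -/

/-- The algebra `D(Q^(N)) ∩ ℓ^∞(X)`. -/
def bddDom : Set (X → ℝ) := {f | f ∈ G.neumannDom m ∧ ∃ K : ℝ, ∀ x, |f x| ≤ K}

/-- The family of all values at `x` of functions in `D(Q^(N)) ∩ ℓ^∞(X)`. -/
def evalAt (x : X) : G.bddDom m → ℝ := fun f => f.1 x

/-- The compactification `X̂` of `X`: the closure of `X` in the product of copies of `ℝ` indexed by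
`D(Q^(N)) ∩ ℓ^∞(X)`.  Its defining properties (a compact Hausdorff space in which `X` is dense and
consists of open points, to which all functions in `D(Q^(N)) ∩ ℓ^∞(X)` extend continuously, the
extensions separating the points) are proved below. -/
def Hat : Type _ := ↥(closure (range (G.evalAt m)))

instance : TopologicalSpace (G.Hat m) :=
  inferInstanceAs (TopologicalSpace ↥(closure (range (G.evalAt m))))

/-- The inclusion of `X` in `X̂`. -/
def incl (x : X) : G.Hat m := ⟨G.evalAt m x, subset_closure ⟨x, rfl⟩⟩

/-- The continuous extension to `X̂` of a function in `D(Q^(N)) ∩ ℓ^∞(X)`. -/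
def bddExt (f : G.bddDom m) (p : G.Hat m) : ℝ := p.1 f

/-- The extension of `f ∈ D(Q^(N))` to `X̂` with values in `[-∞, ∞]`: its value at `p` is the limit
of `f x` as `x ∈ X` tends to `p`.  It exists and is continuous in `p`, as proved below. -/
def ext (f : X → ℝ) (p : G.Hat m) : EReal :=
  limUnder (comap (G.incl m) (𝓝 p)) (fun x => (f x : EReal))

/-- The `1`-harmonic boundary `∂X`. -/
def Bdry : Type _ :=
  {p : G.Hat m // p ∉ range (G.incl m) ∧
    ∀ f : G.bddDom m, (f : X → ℝ) ∈ G.dirichletDom m → G.bddExt m f p = 0}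

instance : TopologicalSpace (G.Bdry m) := instTopologicalSpaceSubtype

instance : MeasurableSpace (G.Bdry m) := borel _

instance : BorelSpace (G.Bdry m) := ⟨rfl⟩

/-- The trace `γ f` of `f ∈ D(Q^(N))` on the boundary. -/
def trace (f : X → ℝ) (z : G.Bdry m) : EReal := G.ext m f z.1

/-- The preliminary trace `γ₀ f` of `f ∈ D(Q^(N)) ∩ ℓ^∞(X)`. -/
def trace₀ (f : G.bddDom m) (z : G.Bdry m) : ℝ := G.bddExt m f z.1

/-! ### The properties of the compactification -/

instance : T2Space (G.Hat m) :=
  inferInstanceAs (T2Space ↥(closure (range (G.evalAt m))))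

theorem continuous_bddExt (f : G.bddDom m) : Continuous (G.bddExt m f) :=
  (continuous_apply f).comp continuous_subtype_val

theorem bddExt_incl (f : G.bddDom m) (x : X) : G.bddExt m f (G.incl m x) = f.1 x := rfl

theorem bddExt_separates {p q : G.Hat m} (h : ∀ f, G.bddExt m f p = G.bddExt m f q) : p = q :=
  Subtype.ext (funext h)

theorem denseRange_incl : DenseRange (G.incl m) := by
  intro p
  refine (closure_subtype (s := range (G.incl m)) (x := p)).2 ?_
  have : (Subtype.val '' range (G.incl m)) = range (G.evalAt m) := by
    ext q
    constructor
    · rintro ⟨_, ⟨x, rfl⟩, rfl⟩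
      exact ⟨x, rfl⟩
    · rintro ⟨x, rfl⟩
      exact ⟨_, ⟨x, rfl⟩, rfl⟩
  exact closure_mono this.ge p.2

instance : CompactSpace (G.Hat m) := by
  choose K hK using fun f : G.bddDom m => f.2.2
  refine isCompact_iff_compactSpace.mp ?_
  refine (isCompact_univ_pi (fun f : G.bddDom m => isCompact_Icc (a := -K f) (b := K f))).of_isClosed_subset
    isClosed_closure ?_
  refine closure_minimal ?_ (isCompact_univ_pi fun f => isCompact_Icc).isClosed
  rintro _ ⟨x, rfl⟩ f _
  exact abs_le.mp (hK f x)

theorem single_mem_bddDom [DecidableEq X] [Countable X] [DiscreteMeasurableSpace X]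
    (hm : ∀ x, m {x} < ∞) (x : X) : (Pi.single x 1 : X → ℝ) ∈ G.bddDom m := by
  refine ⟨⟨?_, G.energy_single_lt_top x⟩, 1, fun y => ?_⟩
  · have h : (Pi.single x 1 : X → ℝ) = indicator {x} (fun _ => (1 : ℝ)) := by
      ext y
      by_cases hy : y = x
      · subst hy; simp
      · simp [hy]
    rw [h]
    exact memLp_indicator_const 2 (measurableSet_singleton x) 1 (Or.inr (hm x).ne)
  · by_cases hy : y = x
    · subst hy; simp
    · simp [hy]

theorem injective_incl [Countable X] [DiscreteMeasurableSpace X]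
    (hm : ∀ x, m {x} < ∞) : Function.Injective (G.incl m) := by
  classical
  intro x y h
  have h2 := congrArg (G.bddExt m ⟨_, G.single_mem_bddDom m hm x⟩) h
  simp only [bddExt_incl] at h2
  by_contra hxy
  simp [Ne.symm hxy] at h2

theorem isOpen_singleton_incl [Countable X] [DiscreteMeasurableSpace X]
    (hm : ∀ x, m {x} < ∞) (x : X) : IsOpen {G.incl m x} := by
  classical
  set e := G.bddExt m ⟨_, G.single_mem_bddDom m hm x⟩ with he
  have hU : IsOpen {p | 1 / 2 < e p} :=
    isOpen_lt continuous_const (G.continuous_bddExt m _)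
  have hsub : {p | 1 / 2 < e p} = {G.incl m x} := by
    refine Subset.antisymm ?_ ?_
    · refine ((G.denseRange_incl m).open_subset_closure_inter hU).trans ?_
      refine closure_minimal ?_ isClosed_singleton
      rintro _ ⟨hp, ⟨y, rfl⟩⟩
      by_cases hy : y = x
      · subst hy; rfl
      · exfalso
        have : e (G.incl m y) = 0 := by simp [he, bddExt_incl, hy]
        have h3 : 1 / 2 < e (G.incl m y) := hp
        rw [this] at h3
        norm_num at h3
    · rintro _ rfl
      have : e (G.incl m x) = 1 := by simp [he, bddExt_incl]
      simp only [mem_ofPred_eq, this]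
      norm_num
  rw [← hsub]
  exact hU

theorem lipschitzWith_arctan : LipschitzWith 1 Real.arctan := by
  refine lipschitzWith_of_nnnorm_deriv_le Real.differentiable_arctan fun x => ?_
  rw [← NNReal.coe_le_coe, coe_nnnorm, Real.deriv_arctan, Real.norm_eq_abs, abs_of_nonneg (by positivity),
    div_le_iff₀ (by positivity)]
  simpa using sq_nonneg x

theorem arctan_mem_bddDom {f : X → ℝ} (hf : f ∈ G.neumannDom m) :
    (fun x => Real.arctan (f x)) ∈ G.bddDom m := by
  have h0 : ∀ t, |Real.arctan t| ≤ |t| := fun t => by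
    simpa [Real.dist_eq] using lipschitzWith_arctan.dist_le_mul t 0
  refine ⟨⟨?_, ?_⟩, Real.pi / 2, fun x => abs_le.2
    ⟨(Real.neg_pi_div_two_lt_arctan _).le, (Real.arctan_lt_pi_div_two _).le⟩⟩
  · refine hf.1.of_le (Real.continuous_arctan.comp_aestronglyMeasurable hf.1.1)
      (Eventually.of_forall fun x => ?_)
    simpa using h0 (f x)
  · refine lt_of_le_of_lt ?_ hf.2
    refine add_le_add (mul_le_mul_right (ENNReal.tsum_le_tsum fun x => ENNReal.tsum_le_tsum
      fun y => ENNReal.ofReal_le_ofReal (mul_le_mul_of_nonneg_left (sq_le_sq.2 ?_)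
        (G.b_nonneg _ _))) _) (ENNReal.tsum_le_tsum fun x => ENNReal.ofReal_le_ofReal
          (mul_le_mul_of_nonneg_left (sq_le_sq.2 (h0 _)) (G.c_nonneg _)))
    simpa [Real.dist_eq] using lipschitzWith_arctan.dist_le_mul (f x) (f y)

theorem exists_continuous_ext {f : X → ℝ} (hf : f ∈ G.neumannDom m) :
    ∃ F : G.Hat m → EReal, Continuous F ∧ ∀ x, F (G.incl m x) = f x := by
  classical
  let T : ℝ → EReal := fun t =>
    if t ≤ -(Real.pi / 2) then ⊥ else if Real.pi / 2 ≤ t then ⊤ else (Real.tan t : EReal)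
  have hTa : ∀ r : ℝ, T (Real.arctan r) = r := fun r => by
    have h1 := Real.neg_pi_div_two_lt_arctan r
    have h2 := Real.arctan_lt_pi_div_two r
    simp only [T]
    rw [if_neg (by linarith), if_neg (by linarith), Real.tan_arctan]
  have hmono : Monotone T := by
    intro s t hst
    simp only [T]
    by_cases h1 : s ≤ -(Real.pi / 2)
    · rw [if_pos h1]; exact bot_le
    by_cases h2 : Real.pi / 2 ≤ t
    · rw [if_neg (by linarith [Real.pi_pos] : ¬ t ≤ -(Real.pi / 2)), if_pos h2]; exact le_top
    rw [if_neg h1, if_neg (by linarith), if_neg (by linarith), if_neg h2]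
    push Not at h1 h2
    exact EReal.coe_le_coe_iff.2
      (Real.strictMonoOn_tan.monotoneOn ⟨h1, by linarith⟩ ⟨by linarith, h2⟩ hst)
  have hsurj : Function.Surjective T := by
    intro r
    induction r with
    | bot => exact ⟨-(Real.pi / 2), by simp [T]⟩
    | coe r => exact ⟨_, hTa r⟩
    | top =>
      refine ⟨Real.pi / 2, ?_⟩
      have : ¬ Real.pi / 2 ≤ -(Real.pi / 2) := by linarith [Real.pi_pos]
      simp only [T]
      rw [if_neg this, if_pos le_rfl]
  refine ⟨fun p => T (G.bddExt m ⟨_, G.arctan_mem_bddDom m hf⟩ p),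
    (hmono.continuous_of_surjective hsurj).comp (G.continuous_bddExt m _), fun x => hTa _⟩

theorem ext_eq_of_continuous {f : X → ℝ} {F : G.Hat m → EReal} (hF : Continuous F)
    (hFf : ∀ x, F (G.incl m x) = f x) : G.ext m f = F := by
  ext1 p
  have : (comap (G.incl m) (𝓝 p)).NeBot :=
    comap_neBot fun t ht => by
      obtain ⟨_, hq, x, rfl⟩ := mem_closure_iff_nhds.1 (G.denseRange_incl m p) t ht
      exact ⟨x, hq⟩
  refine Tendsto.limUnder_eq ?_
  have := (hF.tendsto p).comp (tendsto_comap (f := G.incl m) (x := 𝓝 p))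
  exact this.congr hFf

theorem continuous_ext {f : X → ℝ} (hf : f ∈ G.neumannDom m) : Continuous (G.ext m f) := by
  obtain ⟨F, hF, hFf⟩ := G.exists_continuous_ext m hf
  rwa [G.ext_eq_of_continuous m hF hFf]

theorem ext_incl {f : X → ℝ} (hf : f ∈ G.neumannDom m) (x : X) :
    G.ext m f (G.incl m x) = f x := by
  obtain ⟨F, hF, hFf⟩ := G.exists_continuous_ext m hf
  rw [G.ext_eq_of_continuous m hF hFf, hFf]

theorem trace_eq_trace₀ (f : G.bddDom m) (z : G.Bdry m) :
    G.trace m f z = (G.trace₀ m f z : EReal) :=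
  congrFun (G.ext_eq_of_continuous m (f := f.1) (F := fun p => (G.bddExt m f p : EReal))
    (continuous_coe_real_ereal.comp (G.continuous_bddExt m f)) fun _ => rfl) z.1

/-! ## Harmonic measures, normal derivatives and Robin boundary conditions -/

/-- `h` is the `1`-harmonic extension `H φ` of `φ : ∂X → [-∞, ∞]`. -/
def IsHarmonicExt (φ : G.Bdry m → EReal) (h : X → ℝ) : Prop :=
  h ∈ G.neumannDom m ∧ (∀ x, G.lap m h x + h x = 0) ∧ G.trace m h = φ

/-- `μ` is the `1`-harmonic measure `μ_o`: a Radon measure on `∂X` of mass at most one with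
`H φ (o) = ∫ φ dμ` for all `φ ∈ ran γ₀`, which, if `1 ∉ D(Q^(N))`, does not charge the point of
`∂X` at which all functions in `ran γ₀` vanish. -/
structure IsHarmonicMeasure (o : X) (μ : Measure (G.Bdry m)) : Prop where
  regular : μ.Regular
  mass_le : μ univ ≤ 1
  repr : ∀ (f : G.bddDom m) (h : X → ℝ), G.IsHarmonicExt m (fun z => (G.trace₀ m f z : EReal)) h →
    h o = ∫ z, G.trace₀ m f z ∂μ
  infty : (fun _ => (1 : ℝ)) ∉ G.neumannDom m →
    ∀ z : G.Bdry m, (∀ f : G.bddDom m, G.trace₀ m f z = 0) → μ {z} = 0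

/-- The functional `∂ₙ f` on `D(Q^(N))`, for `f ∈ D(Q^(N))` with `ℒ f ∈ ℓ²(X, m)`. -/
def normalFunctional (f g : X → ℝ) : ℝ :=
  G.energyBilin f g - ∫ x, G.lap m f x * g x ∂m

variable (μ : Measure (G.Bdry m))

/-- The domain of `∂_{n,μ}`: functions whose normal derivative is given by a function `φ` in
`L²(∂X, μ)`. -/
def normalDerivDom : Set (X → ℝ) :=
  {f | f ∈ G.neumannDom m ∧ MemLp (G.lap m f) 2 m ∧ ∃ φ : Lp ℝ 2 μ, ∀ g ∈ G.neumannDom m,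
    ∫ z, φ z * (G.trace m g z).toReal ∂μ = G.normalFunctional m f g}

open Classical in
/-- The normal derivative `∂_{n,μ} f` with respect to `μ`. -/
def normalDeriv (f : X → ℝ) : Lp ℝ 2 μ :=
  if h : f ∈ G.normalDerivDom m μ then h.2.2.choose else 0

/-- The kernel of `∂_{n,μ}`. -/
def normalDerivKer : Set (X → ℝ) :=
  {f | f ∈ G.normalDerivDom m μ ∧ G.normalDeriv m μ f = 0}

variable (β : G.Bdry m → ℝ≥0∞)

/-- `∫_{∂X} |f|² β dμ`, an integral with values in `[0, ∞]`. -/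
def bdryEnergy (f : X → ℝ) : ℝ≥0∞ := ∫⁻ z, (G.trace m f z).abs ^ 2 * β z ∂μ

/-- `∫_{∂X} f g β dμ`, the integral of `f g` with respect to the measure `β μ`, for `f, g` with
square integrable traces. -/
def bdryBilin (f g : X → ℝ) : ℝ :=
  ∫ z, (G.trace m f z).toReal * (G.trace m g z).toReal ∂(μ.withDensity β)

/-- The form `Q^β`. -/
def robinForm : HForm (Lp ℝ 2 m) where
  dom := {f | (f : X → ℝ) ∈ G.neumannDom m ∧ G.bdryEnergy m μ β f < ∞}
  val f g := G.energyBilin f g + G.bdryBilin m μ β f g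

/-- The support `F_β` of the measure `1_{β = ∞} μ`. -/
def bdryF : Set (G.Bdry m) :=
  {z | ∀ U : Set (G.Bdry m), IsOpen U → z ∈ U → 0 < μ ({w | β w = ∞} ∩ U)}

/-- The domain `D(L^β)` of the Laplacian with generalized Robin boundary conditions: `f = 0` on
`F_β`, and `(β + ∂ₙ) f = 0` on `∂X \ F_β` in the weak sense. -/
def robinDom : Set (X → ℝ) :=
  {f | f ∈ G.neumannDom m ∧ MemLp (G.lap m f) 2 m ∧ G.bdryEnergy m μ β f < ∞ ∧
    (∀ z ∈ G.bdryF m μ β, G.trace m f z = 0) ∧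
    ∀ g ∈ G.neumannDom m, G.bdryEnergy m μ β g < ∞ → (∀ z ∈ G.bdryF m μ β, G.trace m g z = 0) →
      G.normalFunctional m f g + G.bdryBilin m μ β f g = 0}

end WGraph

end

/-!
The space `D(Q^(N))` with the form norm is a Hilbert space in which point evaluations are
continuous, and normal contractions act on it without increasing the energy. Its orthogonal
decomposition with respect to `D(Q^(D))` splits every bounded function into a part vanishing on the
boundary and a part `h` with `Lh + h = 0`. The defining property of a harmonic measure, applied to
`min(1, |f|)`, then bounds `∫ min(1, |f|) dμ` by the form norm of `f`. Hence form convergence yields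
convergence of the traces `μ`-almost everywhere along a subsequence, and by Fatou's lemma every
`Q^β` is closed. Its self-adjoint operator is recovered by the Riesz representation theorem, and
testing with the functions of finite support shows that it acts as the formal Laplacian.

Two facts about the boundary remain. First, a function in `D(Q^(N))` with vanishing trace lies in
`D(Q^(D))`: on the compact set where it is at least `ε` it is dominated by functions from
`D(Q^(D))`, so truncating it and cutting off its small values produces approximants.
Second, if the trace vanishes only `μ`-almost everywhere, the harmonic part vanishes at `o`, and on
a connected graph the minimum principle makes it vanish identically. For the kernel of the normal
derivative, the bounded traces and the constants form an algebra that is dense in `C(∂X)` by the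
Stone–Weierstrass theorem.
-/

noncomputable section

/-! ## The self-adjoint operator of a closed form -/

section SelfAdjoint

variable {𝕜 E : Type*} [RCLike 𝕜] [NormedAddCommGroup E] [InnerProductSpace 𝕜 E] [CompleteSpace E]
  {A : E →ₗ.[𝕜] E}

theorem dense_domain_of_isFormalAdjoint_self (hA : A.IsFormalAdjoint A)
    (hsurj : ∀ v, ∃ w : A.domain, A w + w = v) : Dense (A.domain : Set E) := by
  rw [Submodule.dense_iff_topologicalClosure_eq_top, Submodule.topologicalClosure_eq_top_iff,
    Submodule.eq_bot_iff]
  intro u hu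
  obtain ⟨w, rfl⟩ := hsurj u
  have hw : (w : E) = 0 := by
    refine ext_inner_right 𝕜 fun v => ?_
    obtain ⟨w', rfl⟩ := hsurj v
    rw [inner_zero_left, inner_add_right, ← hA w w', ← inner_add_left]
    exact (Submodule.mem_orthogonal' _ _).1 hu w' w'.2
  rw [Subtype.ext (a2 := (0 : A.domain)) hw, A.map_zero, Submodule.coe_zero, add_zero]

theorem isSelfAdjoint_of_isFormalAdjoint_self (hA : A.IsFormalAdjoint A)
    (hsurj : ∀ v, ∃ w : A.domain, A w + w = v) : IsSelfAdjoint A := by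
  have hdense := dense_domain_of_isFormalAdjoint_self hA hsurj
  have hle : A ≤ A.adjoint := hA.le_adjoint hdense
  rw [LinearPMap.isSelfAdjoint_def]
  refine (LinearPMap.eq_of_le_of_domain_eq hle (le_antisymm hle.1 fun u hu => ?_)).symm
  obtain ⟨w, hw⟩ := hsurj (A.adjoint ⟨u, hu⟩ + u)
  suffices u = w from this ▸ w.2
  refine ext_inner_right 𝕜 fun v => ?_
  obtain ⟨g, rfl⟩ := hsurj v
  calc inner 𝕜 u (A g + g) = inner 𝕜 (A.adjoint ⟨u, hu⟩ + u) (g : E) := by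
        rw [inner_add_left, inner_add_right, A.adjoint_isFormalAdjoint hdense ⟨u, hu⟩ g]
    _ = inner 𝕜 (w : E) (A g + g) := by
        rw [← hw, inner_add_left, inner_add_right, hA w g]

end SelfAdjoint

namespace HForm.IsForm

variable {H : Type*} [NormedAddCommGroup H] [InnerProductSpace ℝ H] {Q : HForm H}

/-- The domain of a form as a linear subspace. -/
def domain (hQ : Q.IsForm) : Submodule ℝ H where
  carrier := Q.dom
  zero_mem' := hQ.zero_mem
  add_mem' := fun ha hb => hQ.add_mem _ ha _ hb
  smul_mem' := fun a _ hf => hQ.smul_mem a _ hf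

/-- The domain of a form, as a type of its own that carries the inner product
`Q(f, g) + ⟨f, g⟩`. -/
def Space (hQ : Q.IsForm) : Type _ := hQ.domain

instance (hQ : Q.IsForm) : AddCommGroup hQ.Space := inferInstanceAs (AddCommGroup hQ.domain)

instance (hQ : Q.IsForm) : Module ℝ hQ.Space := inferInstanceAs (Module ℝ hQ.domain)

/-- An element of the domain as an element of the form space. -/
def ofDom (hQ : Q.IsForm) (f : H) (hf : f ∈ Q.dom) : hQ.Space := ⟨f, hf⟩

/-- The inclusion of the form space in `H`. -/
def toH (hQ : Q.IsForm) : hQ.Space →ₗ[ℝ] H := hQ.domain.subtype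

theorem toH_mem (hQ : Q.IsForm) (f : hQ.Space) : hQ.toH f ∈ Q.dom := f.2

@[simp]
theorem toH_ofDom (hQ : Q.IsForm) {f : H} (hf : f ∈ Q.dom) : hQ.toH (hQ.ofDom f hf) = f := rfl

theorem toH_injective (hQ : Q.IsForm) : Function.Injective hQ.toH := Subtype.val_injective

theorem val_add_right (hQ : Q.IsForm) {f g h : H} (hf : f ∈ Q.dom) (hg : g ∈ Q.dom)
    (hh : h ∈ Q.dom) : Q.val f (g + h) = Q.val f g + Q.val f h := by
  simpa using hQ.linear f hf g hg h hh 1 1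

theorem val_smul_right (hQ : Q.IsForm) {f g : H} (hf : f ∈ Q.dom) (hg : g ∈ Q.dom) (a : ℝ) :
    Q.val f (a • g) = a * Q.val f g := by
  simpa using hQ.linear f hf g hg g hg a 0

theorem val_zero_right (hQ : Q.IsForm) {f : H} (hf : f ∈ Q.dom) : Q.val f 0 = 0 := by
  simpa using hQ.val_smul_right hf hQ.zero_mem 0

/-- The inner product `Q(f, g) + ⟨f, g⟩` of the form space. -/
@[reducible]
def innerCore (hQ : Q.IsForm) : InnerProductSpace.Core ℝ hQ.Space where
  inner f g := Q.val (hQ.toH f) (hQ.toH g) + inner ℝ (hQ.toH f) (hQ.toH g)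
  conj_inner_symm f g := by
    simp only [conj_trivial]
    rw [hQ.symm _ (hQ.toH_mem g) _ (hQ.toH_mem f), real_inner_comm]
  re_inner_nonneg f := add_nonneg (hQ.nonneg _ (hQ.toH_mem f)) real_inner_self_nonneg
  add_left f g h := by
    simp only [map_add, inner_add_left]
    rw [hQ.symm _ (hQ.add_mem _ (hQ.toH_mem f) _ (hQ.toH_mem g)) _ (hQ.toH_mem h),
      hQ.val_add_right (hQ.toH_mem h) (hQ.toH_mem f) (hQ.toH_mem g),
      hQ.symm _ (hQ.toH_mem h) _ (hQ.toH_mem f), hQ.symm _ (hQ.toH_mem h) _ (hQ.toH_mem g)]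
    ring
  smul_left f g a := by
    simp only [map_smul, real_inner_smul_left, conj_trivial]
    rw [hQ.symm _ (hQ.smul_mem _ _ (hQ.toH_mem f)) _ (hQ.toH_mem g),
      hQ.val_smul_right (hQ.toH_mem g) (hQ.toH_mem f), hQ.symm _ (hQ.toH_mem g) _ (hQ.toH_mem f)]
    ring
  definite f h := by
    have hval := hQ.nonneg _ (hQ.toH_mem f)
    have hinner := real_inner_self_nonneg (x := hQ.toH f)
    have hzero : inner ℝ (hQ.toH f) (hQ.toH f) = 0 := by linarith
    exact hQ.toH_injective (by simpa using inner_self_eq_zero.1 hzero)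

instance (hQ : Q.IsForm) : NormedAddCommGroup hQ.Space := hQ.innerCore.toNormedAddCommGroup

instance (hQ : Q.IsForm) : InnerProductSpace ℝ hQ.Space :=
  InnerProductSpace.ofCore hQ.innerCore.toCore

theorem inner_def (hQ : Q.IsForm) (f g : hQ.Space) :
    inner ℝ f g = Q.val (hQ.toH f) (hQ.toH g) + inner ℝ (hQ.toH f) (hQ.toH g) := rfl

theorem norm_sq_eq (hQ : Q.IsForm) (f : hQ.Space) : ‖f‖ ^ 2 = Q.normSq (hQ.toH f) := by
  rw [← real_inner_self_eq_norm_sq, inner_def, normSq, real_inner_self_eq_norm_sq]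

theorem norm_toH_le (hQ : Q.IsForm) (f : hQ.Space) : ‖hQ.toH f‖ ≤ ‖f‖ := by
  refine le_of_sq_le_sq ?_ (norm_nonneg _)
  rw [norm_sq_eq, normSq]
  linarith [hQ.nonneg _ (hQ.toH_mem f)]

theorem lipschitzWith_toH (hQ : Q.IsForm) : LipschitzWith 1 hQ.toH := by
  simpa using AddMonoidHomClass.lipschitz_of_bound hQ.toH 1 (by simpa using hQ.norm_toH_le)

theorem tendsto_iff_normSq (hQ : Q.IsForm) {ι : Type*} {l : Filter ι} {u : ι → hQ.Space}
    {f : hQ.Space} :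
    Tendsto u l (𝓝 f) ↔ Tendsto (fun i => Q.normSq (hQ.toH (u i) - hQ.toH f)) l (𝓝 0) := by
  rw [tendsto_iff_norm_sub_tendsto_zero]
  simp only [← map_sub, ← norm_sq_eq]
  refine ⟨fun h => by simpa using h.pow 2, fun h => ?_⟩
  simpa [Function.comp_def, Real.sqrt_sq] using (Real.continuous_sqrt.tendsto 0).comp h

theorem completeSpace (hQ : Q.IsForm) (hc : Q.Closed) : CompleteSpace hQ.Space := by
  refine Metric.complete_of_cauchySeq_tendsto fun u hu => ?_
  obtain ⟨f, hf, hlim⟩ := hc (fun n => hQ.toH (u n)) (fun n => hQ.toH_mem _) fun ε hε => by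
    obtain ⟨N, hN⟩ := Metric.cauchySeq_iff.1 hu (√ε) (Real.sqrt_pos.2 hε)
    refine ⟨N, fun n hn k hk => ?_⟩
    rw [← map_sub, ← norm_sq_eq, ← dist_eq_norm, ← Real.sq_sqrt hε.le]
    exact pow_lt_pow_left₀ (hN n hn k hk) dist_nonneg two_ne_zero
  exact ⟨hQ.ofDom f hf, hQ.tendsto_iff_normSq.2 hlim⟩

/-- The inclusion of the form space of `Q` in that of a form with a larger domain. -/
def inclusion {Q' : HForm H} (hQ : Q.IsForm) (hQ' : Q'.IsForm) (hdom : Q.dom ⊆ Q'.dom) :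
    hQ.Space →ₗ[ℝ] hQ'.Space :=
  Submodule.inclusion (p := hQ.domain) (p' := hQ'.domain) hdom

theorem toH_inclusion {Q' : HForm H} (hQ : Q.IsForm) (hQ' : Q'.IsForm) (hdom : Q.dom ⊆ Q'.dom)
    (f : hQ.Space) : hQ'.toH (hQ.inclusion hQ' hdom f) = hQ.toH f := rfl

theorem lipschitzWith_inclusion {Q' : HForm H} (hQ : Q.IsForm) (hQ' : Q'.IsForm)
    (hdom : Q.dom ⊆ Q'.dom) (hval : ∀ f ∈ Q.dom, Q'.val f f ≤ Q.val f f) :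
    LipschitzWith 1 (hQ.inclusion hQ' hdom) := by
  have hbound (f : hQ.Space) : ‖hQ.inclusion hQ' hdom f‖ ≤ ‖f‖ := by
    refine le_of_sq_le_sq ?_ (norm_nonneg _)
    rw [norm_sq_eq, norm_sq_eq, toH_inclusion]
    exact add_le_add_left (hval _ (hQ.toH_mem f)) _
  simpa using AddMonoidHomClass.lipschitz_of_bound (hQ.inclusion hQ' hdom) 1 (by simpa using hbound)

theorem closed_of_val_le_of_tendsto [CompleteSpace H] (hQ : Q.IsForm)
    (h : ∀ (u : ℕ → hQ.Space) (f : H) (C : ℝ), CauchySeq u →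
      Tendsto (fun n => hQ.toH (u n)) atTop (𝓝 f) →
      (∀ᶠ n in atTop, Q.val (hQ.toH (u n)) (hQ.toH (u n)) ≤ C) → f ∈ Q.dom ∧ Q.val f f ≤ C) :
    Q.Closed := by
  intro u hu hcau
  let U : ℕ → hQ.Space := fun n => hQ.ofDom (u n) (hu n)
  have hU : CauchySeq U := Metric.cauchySeq_iff.2 fun ε hε => by
    obtain ⟨N, hN⟩ := hcau (ε ^ 2) (by positivity)
    refine ⟨N, fun n hn k hk => lt_of_pow_lt_pow_left₀ 2 hε.le ?_⟩
    rw [dist_eq_norm, norm_sq_eq]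
    exact hN n hn k hk
  obtain ⟨f, hf⟩ := cauchySeq_tendsto_of_complete
    (hQ.lipschitzWith_toH.uniformContinuous.comp_cauchySeq hU)
  have hdiff : ∀ ε > 0, ∀ᶠ n in atTop, u n - f ∈ Q.dom ∧ Q.val (u n - f) (u n - f) ≤ ε := by
    intro ε hε
    obtain ⟨N, hN⟩ := hcau ε hε
    filter_upwards [eventually_ge_atTop N] with n hn
    refine h (fun k => U n - U k) (u n - f) ε
      ((uniformContinuous_const.sub uniformContinuous_id).comp_cauchySeq hU)
      (by simp only [map_sub]; exact tendsto_const_nhds.sub hf) ?_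
    filter_upwards [eventually_ge_atTop N] with k hk
    have hlt := hN n hn k hk
    rw [normSq] at hlt
    rw [map_sub]
    exact (le_add_of_nonneg_right (sq_nonneg _)).trans hlt.le
  obtain ⟨n, hn⟩ := (hdiff 1 one_pos).exists
  refine ⟨f, sub_sub_cancel (u n) f ▸ hQ.domain.sub_mem (hu n) hn.1, ?_⟩
  have hval : Tendsto (fun n => Q.val (u n - f) (u n - f)) atTop (𝓝 0) := by
    refine tendsto_order.2 ⟨fun a ha => ?_, fun a ha => ?_⟩
    · filter_upwards [hdiff 1 one_pos] with n hn using ha.trans_le (hQ.nonneg _ hn.1)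
    · filter_upwards [hdiff (a / 2) (half_pos ha)] with n hn using hn.2.trans_lt (half_lt_self ha)
  have hnorm : Tendsto (fun n => ‖u n - f‖) atTop (𝓝 0) := tendsto_iff_norm_sub_tendsto_zero.1 hf
  simpa [normSq] using hval.add (hnorm.pow 2)

theorem exists_val_add_inner_eq (hQ : Q.IsForm) (hc : Q.Closed) (v : H) :
    ∃ w ∈ Q.dom, ∀ g ∈ Q.dom, Q.val w g + inner ℝ w g = inner ℝ v g := by
  have := hQ.completeSpace hc
  let ℓ : hQ.Space →L[ℝ] ℝ := ((innerₛₗ ℝ v).comp hQ.toH).mkContinuous ‖v‖ fun f =>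
    (norm_inner_le_norm v (hQ.toH f)).trans
      (mul_le_mul_of_nonneg_left (hQ.norm_toH_le f) (norm_nonneg v))
  exact ⟨hQ.toH ((InnerProductSpace.toDual ℝ _).symm ℓ), hQ.toH_mem _, fun g hg =>
    InnerProductSpace.toDual_symm_apply (𝕜 := ℝ) (x := hQ.ofDom g hg) (y := ℓ)⟩

/-- The graph of the operator of a form. -/
def operatorGraph (hQ : Q.IsForm) : Submodule ℝ (H × H) where
  carrier := {p | p.1 ∈ Q.dom ∧ ∀ g ∈ Q.dom, Q.val g p.1 = inner ℝ g p.2}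
  zero_mem' := ⟨hQ.zero_mem, fun g hg => by simpa using hQ.val_zero_right hg⟩
  add_mem' := fun ha hb => ⟨hQ.add_mem _ ha.1 _ hb.1, fun g hg => by
    rw [Prod.fst_add, hQ.val_add_right hg ha.1 hb.1, ha.2 g hg, hb.2 g hg, Prod.snd_add,
      inner_add_right]⟩
  smul_mem' := fun a p hp => ⟨hQ.smul_mem _ _ hp.1, fun g hg => by
    rw [Prod.smul_fst, hQ.val_smul_right hg hp.1, hp.2 g hg, Prod.smul_snd,
      real_inner_smul_right]⟩

/-- The operator `L` of a form: `f ∈ D(L)` and `L f = v` if and only if `f ∈ D(Q)` and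
`Q(·, f) = ⟨·, v⟩` on `D(Q)`.  Only for densely defined `Q` is `v` determined by `f`. -/
def operator (hQ : Q.IsForm) : H →ₗ.[ℝ] H := hQ.operatorGraph.toLinearPMap

theorem mem_operator_domain_iff (hQ : Q.IsForm) {f : H} :
    f ∈ hQ.operator.domain ↔ f ∈ Q.dom ∧ ∃ v, ∀ g ∈ Q.dom, Q.val g f = inner ℝ g v := by
  rw [operator, Submodule.toLinearPMap_domain, Submodule.mem_map]
  constructor
  · rintro ⟨p, hp, rfl⟩
    exact ⟨hp.1, p.2, hp.2⟩
  · rintro ⟨hf, v, hv⟩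
    exact ⟨(f, v), ⟨hf, hv⟩, rfl⟩

theorem operator_domain_subset (hQ : Q.IsForm) : (hQ.operator.domain : Set H) ⊆ Q.dom :=
  fun _ hf => (hQ.mem_operator_domain_iff.1 hf).1

theorem val_eq_inner_operator (hQ : Q.IsForm) (hd : Dense Q.dom) (f : hQ.operator.domain) {g : H}
    (hg : g ∈ Q.dom) : Q.val g f = inner ℝ g (hQ.operator f) := by
  have hsnd : ∀ p ∈ hQ.operatorGraph, p.1 = 0 → p.2 = 0 := fun p hp h0 =>
    hd.eq_zero_of_inner_right ℝ fun g hg => by rw [← hp.2 g hg, h0, hQ.val_zero_right hg]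
  exact (Submodule.mem_graph_toLinearPMap hsnd f).2 g hg

theorem isFormalAdjoint_operator (hQ : Q.IsForm) (hd : Dense Q.dom) :
    hQ.operator.IsFormalAdjoint hQ.operator := fun f g => by
  have hf := hQ.operator_domain_subset f.2
  have hg := hQ.operator_domain_subset g.2
  rw [real_inner_comm, ← hQ.val_eq_inner_operator hd f hg, ← hQ.val_eq_inner_operator hd g hf,
    hQ.symm _ hg _ hf]

theorem exists_operator_add_self_eq (hQ : Q.IsForm) (hc : Q.Closed) (hd : Dense Q.dom) (v : H) :
    ∃ w : hQ.operator.domain, hQ.operator w + w = v := by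
  obtain ⟨w, hw, hwv⟩ := hQ.exists_val_add_inner_eq hc v
  have hval : ∀ g ∈ Q.dom, Q.val g w = inner ℝ g (v - w) := fun g hg => by
    rw [hQ.symm g hg w hw, inner_sub_right, real_inner_comm v g, real_inner_comm w g, ← hwv g hg,
      add_sub_cancel_right]
  refine ⟨⟨w, hQ.mem_operator_domain_iff.2 ⟨hw, _, hval⟩⟩, eq_sub_iff_add_eq.1 ?_⟩
  rw [← sub_eq_zero]
  exact hd.eq_zero_of_inner_right ℝ fun g hg => by
    rw [inner_sub_right, ← hQ.val_eq_inner_operator hd _ hg, ← hval g hg, sub_self]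

theorem isOperatorOf_operator [CompleteSpace H] (hQ : Q.IsForm) (hc : Q.Closed)
    (hd : Dense Q.dom) : IsOperatorOf hQ.operator Q where
  dense := dense_domain_of_isFormalAdjoint_self (hQ.isFormalAdjoint_operator hd)
    (hQ.exists_operator_add_self_eq hc hd)
  selfAdjoint := isSelfAdjoint_of_isFormalAdjoint_self (hQ.isFormalAdjoint_operator hd)
    (hQ.exists_operator_add_self_eq hc hd)
  nonneg g := by
    have hg := hQ.operator_domain_subset g.2
    rw [real_inner_comm, ← hQ.val_eq_inner_operator hd g hg]
    exact hQ.nonneg _ hg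
  domain_subset := hQ.operator_domain_subset
  val_eq _ hf g := hQ.val_eq_inner_operator hd g hf

/-- The restriction of a form to a subspace of its domain. -/
def restrict (hQ : Q.IsForm) (V : Submodule ℝ hQ.Space) : HForm H := ⟨hQ.toH '' V, Q.val⟩

theorem isForm_restrict (hQ : Q.IsForm) (V : Submodule ℝ hQ.Space) : (hQ.restrict V).IsForm := by
  have hsub : ∀ f ∈ (hQ.restrict V).dom, f ∈ Q.dom := by
    rintro _ ⟨f, -, rfl⟩
    exact hQ.toH_mem f
  exact {
    zero_mem := (V.map hQ.toH).zero_mem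
    add_mem := fun _ hf _ hg => (V.map hQ.toH).add_mem hf hg
    smul_mem := fun a _ hf => (V.map hQ.toH).smul_mem a hf
    symm := fun f hf g hg => hQ.symm f (hsub f hf) g (hsub g hg)
    linear := fun f hf g hg h hh => hQ.linear f (hsub f hf) g (hsub g hg) h (hsub h hh)
    nonneg := fun f hf => hQ.nonneg f (hsub f hf) }

theorem closed_restrict (hQ : Q.IsForm) (hc : Q.Closed) {V : Submodule ℝ hQ.Space}
    (hV : IsClosed (V : Set hQ.Space)) : (hQ.restrict V).Closed := by
  intro u hu hcau
  choose U hUV hUu using hu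
  obtain ⟨f, hf, hlim⟩ := hc u (fun n => hUu n ▸ hQ.toH_mem (U n)) hcau
  refine ⟨f, ⟨hQ.ofDom f hf, hV.mem_of_tendsto (b := atTop) (hQ.tendsto_iff_normSq.2 ?_)
    (Eventually.of_forall hUV), hQ.toH_ofDom hf⟩, hlim⟩
  simpa only [hUu, toH_ofDom] using hlim

end HForm.IsForm

/-! ## Functions of finite energy -/

theorem tsum_le_of_tendsto_of_eventually_tsum_le {ι κ : Type*} {l : Filter κ} [l.NeBot]
    {a : κ → ι → ℝ≥0∞} {a₀ : ι → ℝ≥0∞} {C : ℝ≥0∞} (h : ∀ i, Tendsto (fun n => a n i) l (𝓝 (a₀ i)))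
    (hC : ∀ᶠ n in l, ∑' i, a n i ≤ C) : ∑' i, a₀ i ≤ C := by
  rw [ENNReal.tsum_eq_iSup_sum]
  refine iSup_le fun s => le_of_tendsto (tendsto_finsetSum s fun i _ => h i) ?_
  filter_upwards [hC] with n hn
  exact (ENNReal.sum_le_tsum s).trans hn

theorem summable_mul_mul_of_summable_mul_sq {ι : Type*} {w u v : ι → ℝ} (hw : ∀ i, 0 ≤ w i)
    (hu : Summable fun i => w i * u i ^ 2) (hv : Summable fun i => w i * v i ^ 2) :
    Summable fun i => w i * u i * v i := by
  refine Summable.of_norm_bounded (hu.add hv) fun i => ?_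
  rw [Real.norm_eq_abs, mul_assoc, abs_mul, abs_of_nonneg (hw i), ← mul_add]
  refine mul_le_mul_of_nonneg_left (abs_le.2 ⟨?_, ?_⟩) (hw i)
  · nlinarith [sq_nonneg (u i + v i), sq_nonneg (u i), sq_nonneg (v i)]
  · nlinarith [sq_nonneg (u i - v i), sq_nonneg (u i), sq_nonneg (v i)]

namespace WGraph

variable {X : Type*}

/-- The discrete gradient of `f`: its differences along all pairs, together with its values.  The
killing term `c` then appears as the weight of an edge to a cemetery at which `f` vanishes, so that
the energy is a single weighted sum of squares. -/
def grad (f : X → ℝ) : (X × X) ⊕ X → ℝ := Sum.elim (fun p => f p.1 - f p.2) f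

theorem grad_add (f g : X → ℝ) (i : (X × X) ⊕ X) : grad (f + g) i = grad f i + grad g i := by
  rcases i with p | x
  · simp only [grad, Sum.elim_inl, Pi.add_apply]; ring
  · rfl

theorem grad_smul (a : ℝ) (f : X → ℝ) (i : (X × X) ⊕ X) : grad (a • f) i = a * grad f i := by
  rcases i with p | x
  · simp only [grad, Sum.elim_inl, Pi.smul_apply, smul_eq_mul]; ring
  · rfl

theorem abs_grad_comp_le {C : ℝ → ℝ} (hC : LipschitzWith 1 C) (hC0 : C 0 = 0) (f : X → ℝ)
    (i : (X × X) ⊕ X) : |grad (C ∘ f) i| ≤ |grad f i| := by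
  rcases i with p | x
  · simpa [grad, Real.dist_eq] using hC.dist_le_mul (f p.1) (f p.2)
  · simpa [grad, Real.dist_eq, hC0] using hC.dist_le_mul (f x) 0

theorem grad_mul_sq_le {f g : X → ℝ} {K K' : ℝ} (hK : ∀ x, |f x| ≤ K) (hK' : ∀ x, |g x| ≤ K')
    (i : (X × X) ⊕ X) :
    grad (f * g) i ^ 2 ≤ 2 * K' ^ 2 * grad f i ^ 2 + 2 * K ^ 2 * grad g i ^ 2 := by
  have hf : ∀ x, f x ^ 2 ≤ K ^ 2 := fun x => sq_le_sq.2 ((hK x).trans (le_abs_self _))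
  have hg : ∀ x, g x ^ 2 ≤ K' ^ 2 := fun x => sq_le_sq.2 ((hK' x).trans (le_abs_self _))
  rcases i with ⟨x, y⟩ | x
  · simp only [grad, Sum.elim_inl, Pi.mul_apply]
    calc (f x * g x - f y * g y) ^ 2 = ((f x - f y) * g x + f y * (g x - g y)) ^ 2 := by ring
      _ ≤ 2 * (((f x - f y) * g x) ^ 2 + (f y * (g x - g y)) ^ 2) := add_sq_le
      _ = 2 * g x ^ 2 * (f x - f y) ^ 2 + 2 * f y ^ 2 * (g x - g y) ^ 2 := by ring
      _ ≤ 2 * K' ^ 2 * (f x - f y) ^ 2 + 2 * K ^ 2 * (g x - g y) ^ 2 := by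
        gcongr ?_ * _ + ?_ * _
        exacts [mul_le_mul_of_nonneg_left (hg x) zero_le_two,
          mul_le_mul_of_nonneg_left (hf y) zero_le_two]
  · simp only [grad, Sum.elim_inr, Pi.mul_apply]
    calc (f x * g x) ^ 2 = g x ^ 2 * f x ^ 2 := by ring
      _ ≤ K' ^ 2 * f x ^ 2 := mul_le_mul_of_nonneg_right (hg x) (sq_nonneg _)
      _ ≤ 2 * K' ^ 2 * f x ^ 2 + 2 * K ^ 2 * g x ^ 2 := by
        nlinarith [mul_nonneg (sq_nonneg K) (sq_nonneg (g x)),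
          mul_nonneg (sq_nonneg K') (sq_nonneg (f x))]

theorem tendsto_grad {κ : Type*} {l : Filter κ} {u : κ → X → ℝ} {f : X → ℝ}
    (h : ∀ x, Tendsto (fun n => u n x) l (𝓝 (f x))) (i : (X × X) ⊕ X) :
    Tendsto (fun n => grad (u n) i) l (𝓝 (grad f i)) := by
  rcases i with p | x
  · exact (h p.1).sub (h p.2)
  · exact h x

variable (G : WGraph X)

/-- The weights that turn the energy into a weighted sum of the squares of `grad`; an edge appears
with both orientations, hence the factor `1 / 2`. -/
def weight : (X × X) ⊕ X → ℝ := Sum.elim (fun p => 1 / 2 * G.b p.1 p.2) G.c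

theorem weight_nonneg (i : (X × X) ⊕ X) : 0 ≤ G.weight i := by
  rcases i with p | x
  · exact mul_nonneg (by norm_num) (G.b_nonneg _ _)
  · exact G.c_nonneg x

theorem weight_mul_grad_sq_nonneg (f : X → ℝ) (i : (X × X) ⊕ X) : 0 ≤ G.weight i * grad f i ^ 2 :=
  mul_nonneg (G.weight_nonneg i) (sq_nonneg _)

/-- `f` has finite energy. -/
def FinEnergy (f : X → ℝ) : Prop := Summable fun i => G.weight i * grad f i ^ 2

theorem energy_eq_tsum_grad (f : X → ℝ) :
    G.energy f = ∑' i, ENNReal.ofReal (G.weight i * grad f i ^ 2) := by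
  rw [Summable.tsum_sum (f := fun i => ENNReal.ofReal (G.weight i * grad f i ^ 2))
    ENNReal.summable ENNReal.summable, energy, ENNReal.tsum_prod', ← ENNReal.tsum_mul_left]
  refine congrArg₂ (· + ·) (tsum_congr fun x => ?_) rfl
  rw [← ENNReal.tsum_mul_left]
  refine tsum_congr fun y => ?_
  rw [weight, grad, Sum.elim_inl, Sum.elim_inl, mul_assoc (1 / 2 : ℝ),
    ENNReal.ofReal_mul (p := 1 / 2) (by norm_num), one_div, ENNReal.ofReal_inv_of_pos (by norm_num),
    ENNReal.ofReal_ofNat]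

theorem energy_lt_top_iff {f : X → ℝ} : G.energy f < ∞ ↔ G.FinEnergy f := by
  rw [energy_eq_tsum_grad]
  refine ⟨fun h => ?_, fun h => h.tsum_ofReal_lt_top⟩
  exact (ENNReal.summable_toReal h.ne).congr fun i =>
    ENNReal.toReal_ofReal (G.weight_mul_grad_sq_nonneg f i)

variable {G}

theorem energy_le_of_tendsto {κ : Type*} {l : Filter κ} [l.NeBot] {u : κ → X → ℝ} {f : X → ℝ}
    {C : ℝ≥0∞} (h : ∀ x, Tendsto (fun n => u n x) l (𝓝 (f x)))
    (hC : ∀ᶠ n in l, G.energy (u n) ≤ C) : G.energy f ≤ C := by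
  simp only [energy_eq_tsum_grad] at hC ⊢
  exact tsum_le_of_tendsto_of_eventually_tsum_le (fun i =>
    ENNReal.tendsto_ofReal (((tendsto_grad h i).pow 2).const_mul (G.weight i))) hC

namespace FinEnergy

variable {f g h : X → ℝ}

theorem summable_grad_mul_grad (hf : G.FinEnergy f) (hg : G.FinEnergy g) :
    Summable fun i => G.weight i * grad f i * grad g i :=
  summable_mul_mul_of_summable_mul_sq G.weight_nonneg hf hg

theorem energyBilin_eq_tsum_grad (hf : G.FinEnergy f) (hg : G.FinEnergy g) :
    G.energyBilin f g = ∑' i, G.weight i * grad f i * grad g i := by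
  have hs := hf.summable_grad_mul_grad hg
  rw [Summable.tsum_sum (f := fun i => G.weight i * grad f i * grad g i)
    (hs.comp_injective Sum.inl_injective) (hs.comp_injective Sum.inr_injective), energyBilin,
    ← tsum_mul_left]
  refine congrArg₂ (· + ·) (tsum_congr fun p => ?_) rfl
  simp only [weight, grad, Sum.elim_inl]
  ring

theorem energyBilin_self (hf : G.FinEnergy f) :
    G.energyBilin f f = ∑' i, G.weight i * grad f i ^ 2 := by
  rw [hf.energyBilin_eq_tsum_grad hf]
  exact tsum_congr fun i => by ring

theorem energyBilin_self_nonneg (hf : G.FinEnergy f) : 0 ≤ G.energyBilin f f := by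
  rw [hf.energyBilin_self]
  exact tsum_nonneg (G.weight_mul_grad_sq_nonneg f)

theorem energy_eq_ofReal (hf : G.FinEnergy f) :
    G.energy f = ENNReal.ofReal (G.energyBilin f f) := by
  rw [energy_eq_tsum_grad, hf.energyBilin_self,
    ENNReal.ofReal_tsum_of_nonneg (G.weight_mul_grad_sq_nonneg f) hf]

theorem energyBilin_comm (hf : G.FinEnergy f) (hg : G.FinEnergy g) :
    G.energyBilin f g = G.energyBilin g f := by
  rw [hf.energyBilin_eq_tsum_grad hg, hg.energyBilin_eq_tsum_grad hf]
  exact tsum_congr fun i => by ring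

theorem smul (hf : G.FinEnergy f) (a : ℝ) : G.FinEnergy (a • f) :=
  (hf.mul_left (a ^ 2)).congr fun i => by rw [grad_smul]; ring

theorem add (hf : G.FinEnergy f) (hg : G.FinEnergy g) : G.FinEnergy (f + g) :=
  ((Summable.add hf hg).add ((hf.summable_grad_mul_grad hg).mul_left 2)).congr fun i => by
    rw [grad_add]; ring

theorem energyBilin_linear (hf : G.FinEnergy f) (hg : G.FinEnergy g) (hh : G.FinEnergy h)
    (a b : ℝ) :
    G.energyBilin f (a • g + b • h) = a * G.energyBilin f g + b * G.energyBilin f h := by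
  rw [hf.energyBilin_eq_tsum_grad ((hg.smul a).add (hh.smul b)), hf.energyBilin_eq_tsum_grad hg,
    hf.energyBilin_eq_tsum_grad hh, ← tsum_mul_left, ← tsum_mul_left,
    ← ((hf.summable_grad_mul_grad hg).mul_left a).tsum_add
      ((hf.summable_grad_mul_grad hh).mul_left b)]
  exact tsum_congr fun i => by rw [grad_add, grad_smul, grad_smul]; ring

theorem comp (hf : G.FinEnergy f) {C : ℝ → ℝ} (hC : LipschitzWith 1 C) (hC0 : C 0 = 0) :
    G.FinEnergy (C ∘ f) :=
  Summable.of_nonneg_of_le (G.weight_mul_grad_sq_nonneg _) (fun i => mul_le_mul_of_nonneg_left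
    (sq_le_sq.2 (abs_grad_comp_le hC hC0 f i)) (G.weight_nonneg i)) hf

theorem energyBilin_comp_le (hf : G.FinEnergy f) {C : ℝ → ℝ} (hC : LipschitzWith 1 C)
    (hC0 : C 0 = 0) : G.energyBilin (C ∘ f) (C ∘ f) ≤ G.energyBilin f f := by
  rw [hf.energyBilin_self, (hf.comp hC hC0).energyBilin_self]
  exact (hf.comp hC hC0).tsum_le_tsum (fun i => mul_le_mul_of_nonneg_left
    (sq_le_sq.2 (abs_grad_comp_le hC hC0 f i)) (G.weight_nonneg i)) hf

theorem mul (hf : G.FinEnergy f) (hg : G.FinEnergy g) {K K' : ℝ} (hK : ∀ x, |f x| ≤ K)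
    (hK' : ∀ x, |g x| ≤ K') : G.FinEnergy (f * g) :=
  Summable.of_nonneg_of_le (G.weight_mul_grad_sq_nonneg _)
    (fun i => (mul_le_mul_of_nonneg_left (grad_mul_sq_le hK hK' i) (G.weight_nonneg i)).trans_eq
      (by ring))
    ((hf.mul_left (2 * K' ^ 2)).add (hg.mul_left (2 * K ^ 2)))

theorem summable_b_mul_sub (hf : G.FinEnergy f) (x : X) :
    Summable fun y => G.b x y * (f x - f y) := by
  have hsq : Summable fun y => G.b x y * (f x - f y) ^ 2 := by
    have h := (Summable.comp_injective hf Sum.inl_injective).comp_injective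
      (Prod.mk_right_injective x)
    refine (h.mul_left 2).congr fun y => ?_
    simp only [Function.comp_apply, weight, grad, Sum.elim_inl]
    ring
  simpa using summable_mul_mul_of_summable_mul_sq (u := 1) (G.b_nonneg x)
    (by simpa using G.b_summable x) hsq

theorem hasSum_single_sub_mul_sub [DecidableEq X] (hf : G.FinEnergy f) (x : X) :
    HasSum (fun p : X × X => G.b p.1 p.2 * ((Pi.single x 1 : X → ℝ) p.1 -
      (Pi.single x 1 : X → ℝ) p.2) * (f p.1 - f p.2)) (2 * ∑' y, G.b x y * (f x - f y)) := by
  have hsum := (hf.summable_b_mul_sub x).hasSum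
  have hout : HasSum (fun p : X × X => if p.1 = x then G.b x p.2 * (f x - f p.2) else 0)
      (∑' y, G.b x y * (f x - f y)) := by
    refine ((Prod.mk_right_injective x).hasSum_iff ?_).1 (by simpa [Function.comp_def] using hsum)
    rintro ⟨u, v⟩ hp
    exact if_neg fun h => hp ⟨v, by rw [← h]⟩
  have hin : HasSum (fun p : X × X => if p.2 = x then G.b x p.1 * (f x - f p.1) else 0)
      (∑' y, G.b x y * (f x - f y)) := by
    refine ((Prod.mk_left_injective x).hasSum_iff ?_).1 (by simpa [Function.comp_def] using hsum)
    rintro ⟨u, v⟩ hp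
    exact if_neg fun h => hp ⟨u, by rw [← h]⟩
  rw [two_mul]
  convert hout.add hin using 2 with p
  obtain ⟨u, v⟩ := p
  by_cases hu : u = x <;> by_cases hv : v = x
  · subst hu; subst hv; simp
  · subst hu; simp [hv]
  · subst hv
    simp only [hu, Pi.single_eq_same, Pi.single_eq_of_ne hu, if_false, if_true, G.b_symm u v]
    ring
  · simp [hu, hv]

theorem energyBilin_single [DecidableEq X] (hf : G.FinEnergy f) (x : X) :
    G.energyBilin (Pi.single x 1) f = ∑' y, G.b x y * (f x - f y) + G.c x * f x := by
  rw [energyBilin, (hf.hasSum_single_sub_mul_sub x).tsum_eq,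
    tsum_eq_single (f := fun y => G.c y * (Pi.single x 1 : X → ℝ) y * f y) x
      (fun y hy => by simp [hy]), Pi.single_eq_same]
  ring

end FinEnergy

end WGraph

/-! ## Square summable functions on a discrete measure space -/

theorem l2_inner_eq_integral {α : Type*} [MeasurableSpace α] {μ : Measure α} (f g : Lp ℝ 2 μ) :
    inner ℝ f g = ∫ x, f x * g x ∂μ := by
  rw [L2.inner_def]
  exact integral_congr_ae (Eventually.of_forall fun x => by simp [mul_comm])

/-- All points have positive finite mass.  Almost everywhere equal functions are then equal, so
that elements of `Lp` can be treated as functions. -/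
class PosFiniteAtoms {X : Type*} [MeasurableSpace X] (m : Measure X) : Prop where
  pos : ∀ x, 0 < m {x}
  lt_top : ∀ x, m {x} < ∞

namespace PosFiniteAtoms

variable {X : Type*} [MeasurableSpace X] {m : Measure X} [PosFiniteAtoms m]

theorem eq_of_ae_eq {α : Type*} {f g : X → α} (h : f =ᵐ[m] g) : f = g := by
  ext x
  by_contra hx
  exact (pos x).ne' (measure_mono_null (by simpa using hx) (ae_iff.1 h))

theorem measureReal_singleton_pos (m : Measure X) [PosFiniteAtoms m] (x : X) : 0 < m.real {x} :=
  ENNReal.toReal_pos (pos x).ne' (lt_top x).ne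

section Coe

variable {E : Type*} [NormedAddCommGroup E] {p : ℝ≥0∞}

theorem coe_add (f g : Lp E p m) : ((f + g : Lp E p m) : X → E) = f + g :=
  eq_of_ae_eq (Lp.coeFn_add f g)

theorem coe_smul [NormedSpace ℝ E] (a : ℝ) (f : Lp E p m) :
    ((a • f : Lp E p m) : X → E) = a • ⇑f :=
  eq_of_ae_eq (Lp.coeFn_smul a f)

theorem coe_zero : ((0 : Lp E p m) : X → E) = 0 :=
  eq_of_ae_eq (Lp.coeFn_zero E p m)

theorem coe_toLp {f : X → E} (hf : MemLp f p m) : (hf.toLp f : X → E) = f :=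
  eq_of_ae_eq hf.coeFn_toLp

theorem coe_compLp {F : Type*} [NormedAddCommGroup F] {K : NNReal} {C : E → F}
    (hC : LipschitzWith K C) (hC0 : C 0 = 0) (f : Lp E p m) : (hC.compLp hC0 f : X → F) = C ∘ f :=
  eq_of_ae_eq (hC.coeFn_compLp hC0 f)

end Coe

theorem forall_coe_iff {E : Type*} [NormedAddCommGroup E] {p : ℝ≥0∞} {P : (X → E) → Prop} :
    (∀ f : Lp E p m, P f) ↔ ∀ f, MemLp f p m → P f :=
  ⟨fun h f hf => coe_toLp hf ▸ h (hf.toLp f), fun h f => h f (Lp.memLp f)⟩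

variable [MeasurableSingletonClass X]

/-- The indicator function of a point in `ℓ²(X, m)`. -/
def delta (m : Measure X) [PosFiniteAtoms m] (x : X) : Lp ℝ 2 m :=
  indicatorConstLp 2 (measurableSet_singleton x) (lt_top x).ne 1

theorem coe_delta [DecidableEq X] (x : X) : (delta m x : X → ℝ) = Pi.single x 1 := by
  rw [delta, eq_of_ae_eq (indicatorConstLp_coeFn (p := 2) (μ := m) (s := {x}) (c := (1 : ℝ))
    (hs := measurableSet_singleton x) (hμs := (lt_top x).ne))]
  ext y
  by_cases hy : y = x
  · subst hy; simp
  · simp [hy]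

theorem inner_delta (x : X) (f : Lp ℝ 2 m) : inner ℝ (delta m x) f = m.real {x} * f x := by
  rw [delta, L2.inner_indicatorConstLp_one, Measure.restrict_singleton, integral_smul_measure,
    integral_dirac, smul_eq_mul, measureReal_def]

theorem continuous_coe_apply (x : X) : Continuous fun f : Lp ℝ 2 m => (f : X → ℝ) x := by
  have hinner : (fun f : Lp ℝ 2 m => (f : X → ℝ) x) =
      fun f => (m.real {x})⁻¹ * inner ℝ (delta m x) f := by
    ext f
    rw [inner_delta, inv_mul_cancel_left₀ (measureReal_singleton_pos m x).ne']
  rw [hinner]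
  fun_prop

theorem mul_sq_apply_le_norm_sq (f : Lp ℝ 2 m) (x : X) : m.real {x} * f x ^ 2 ≤ ‖f‖ ^ 2 := by
  classical
  have h := real_inner_mul_inner_self_le (delta m x) f
  rw [inner_delta, inner_delta, coe_delta, Pi.single_eq_same, real_inner_self_eq_norm_sq] at h
  refine le_of_mul_le_mul_left ?_ (measureReal_singleton_pos m x)
  linarith

theorem dense_dom_of_delta_mem {Q : HForm (Lp ℝ 2 m)} (hQ : Q.IsForm)
    (h : ∀ x, delta m x ∈ Q.dom) : Dense Q.dom := by
  change Dense (hQ.domain : Set (Lp ℝ 2 m))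
  rw [Submodule.dense_iff_topologicalClosure_eq_top, Submodule.topologicalClosure_eq_top_iff,
    Submodule.eq_bot_iff]
  intro f hf
  ext1
  refine Eventually.of_forall fun x => ?_
  have hx : m.real {x} * f x = 0 := by
    rw [← inner_delta]
    exact (Submodule.mem_orthogonal _ _).1 hf _ (h x)
  rw [coe_zero, (mul_eq_zero.1 hx).resolve_left (measureReal_singleton_pos m x).ne', Pi.zero_apply]

end PosFiniteAtoms

/-! ## The Neumann form -/

namespace WGraph

open PosFiniteAtoms

section Domain

variable {X : Type*} [MeasurableSpace X] {G : WGraph X} {m : Measure X} {f g : X → ℝ}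

theorem mem_neumannDom : f ∈ G.neumannDom m ↔ MemLp f 2 m ∧ G.FinEnergy f := by
  rw [neumannDom, mem_ofPred_eq, G.energy_lt_top_iff]

theorem comp_mem_neumannDom (hf : f ∈ G.neumannDom m) {C : ℝ → ℝ} (hC : LipschitzWith 1 C)
    (hC0 : C 0 = 0) : C ∘ f ∈ G.neumannDom m := by
  rw [mem_neumannDom] at hf ⊢
  exact ⟨hC.comp_memLp hC0 hf.1, hf.2.comp hC hC0⟩

theorem add_mem_neumannDom (hf : f ∈ G.neumannDom m) (hg : g ∈ G.neumannDom m) :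
    f + g ∈ G.neumannDom m := by
  rw [mem_neumannDom] at hf hg ⊢
  exact ⟨hf.1.add hg.1, hf.2.add hg.2⟩

theorem smul_mem_neumannDom (hf : f ∈ G.neumannDom m) (a : ℝ) : a • f ∈ G.neumannDom m := by
  rw [mem_neumannDom] at hf ⊢
  exact ⟨hf.1.const_smul a, hf.2.smul a⟩

theorem add_mem_bddDom (hf : f ∈ G.bddDom m) (hg : g ∈ G.bddDom m) : f + g ∈ G.bddDom m := by
  obtain ⟨hf, K, hK⟩ := hf
  obtain ⟨hg, K', hK'⟩ := hg
  exact ⟨add_mem_neumannDom hf hg, K + K', fun x =>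
    (abs_add_le _ _).trans (add_le_add (hK x) (hK' x))⟩

theorem smul_mem_bddDom (hf : f ∈ G.bddDom m) (a : ℝ) : a • f ∈ G.bddDom m := by
  obtain ⟨hf, K, hK⟩ := hf
  refine ⟨smul_mem_neumannDom hf a, |a| * K, fun x => ?_⟩
  rw [Pi.smul_apply, smul_eq_mul, abs_mul]
  exact mul_le_mul_of_nonneg_left (hK x) (abs_nonneg a)

theorem mul_mem_bddDom (hf : f ∈ G.bddDom m) (hg : g ∈ G.bddDom m) : f * g ∈ G.bddDom m := by
  obtain ⟨hf, K, hK⟩ := hf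
  obtain ⟨hg, K', hK'⟩ := hg
  rw [mem_neumannDom] at hf hg
  refine ⟨mem_neumannDom.2 ⟨?_, hf.2.mul hg.2 hK hK'⟩, K * K', fun x => ?_⟩
  · refine (hg.1.const_smul K).of_le (hf.1.1.mul hg.1.1) (Eventually.of_forall fun x => ?_)
    simp only [Pi.mul_apply, Pi.smul_apply, smul_eq_mul, norm_mul, Real.norm_eq_abs]
    exact mul_le_mul_of_nonneg_right ((hK x).trans (le_abs_self K)) (abs_nonneg _)
  · rw [Pi.mul_apply, abs_mul]
    exact mul_le_mul (hK x) (hK' x) (abs_nonneg _) ((abs_nonneg _).trans (hK x))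

end Domain

variable {X : Type*} [MeasurableSpace X] (G : WGraph X) (m : Measure X) [PosFiniteAtoms m]

theorem neumannForm_isForm : (G.neumannForm m).IsForm where
  zero_mem := by
    change ((0 : Lp ℝ 2 m) : X → ℝ) ∈ G.neumannDom m
    rw [coe_zero, mem_neumannDom]
    exact ⟨MemLp.zero, summable_zero.congr fun i => by rcases i with p | x <;> simp [grad]⟩
  add_mem f hf g hg := by
    change ((f + g : Lp ℝ 2 m) : X → ℝ) ∈ G.neumannDom m
    rw [coe_add]
    exact add_mem_neumannDom hf hg
  smul_mem a f hf := by
    change ((a • f : Lp ℝ 2 m) : X → ℝ) ∈ G.neumannDom m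
    rw [coe_smul]
    exact smul_mem_neumannDom hf a
  symm f hf g hg := (mem_neumannDom.1 hf).2.energyBilin_comm (mem_neumannDom.1 hg).2
  linear f hf g hg h hh a b := by
    simp only [neumannForm, coe_add, coe_smul]
    exact (mem_neumannDom.1 hf).2.energyBilin_linear (mem_neumannDom.1 hg).2
      (mem_neumannDom.1 hh).2 a b
  nonneg f hf := (mem_neumannDom.1 hf).2.energyBilin_self_nonneg

/-- The domain of the Neumann form as an inner product space. -/
abbrev NSpace : Type _ := (G.neumannForm_isForm m).Space

/-- An element of the Neumann space as an element of `ℓ²(X, m)`. -/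
abbrev toL2 : G.NSpace m →ₗ[ℝ] Lp ℝ 2 m := (G.neumannForm_isForm m).toH

/-- An element of the Neumann space as a function on `X`. -/
def fn : G.NSpace m →ₗ[ℝ] (X → ℝ) where
  toFun F := G.toL2 m F
  map_add' _ _ := by rw [map_add, coe_add]
  map_smul' a F := by rw [map_smul, coe_smul, RingHom.id_apply]

variable {G m}

theorem fn_eq_coe (F : G.NSpace m) : G.fn m F = G.toL2 m F := rfl

theorem fn_mem (F : G.NSpace m) : G.fn m F ∈ G.neumannDom m := (G.neumannForm_isForm m).toH_mem F

theorem fn_finEnergy (F : G.NSpace m) : G.FinEnergy (G.fn m F) := (mem_neumannDom.1 (fn_mem F)).2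

theorem fn_injective : Function.Injective (G.fn m) := fun _ _ h =>
  (G.neumannForm_isForm m).toH_injective (Lp.ext (Eventually.of_forall (congrFun h)))

/-- An element of the Neumann domain as an element of the Neumann space. -/
def toN {f : X → ℝ} (hf : f ∈ G.neumannDom m) : G.NSpace m :=
  (G.neumannForm_isForm m).ofDom (hf.1.toLp f) (by
    change (hf.1.toLp f : X → ℝ) ∈ G.neumannDom m
    rwa [coe_toLp])

@[simp]
theorem fn_toN {f : X → ℝ} (hf : f ∈ G.neumannDom m) : G.fn m (toN hf) = f := by
  rw [fn_eq_coe, toN, HForm.IsForm.toH_ofDom, coe_toLp]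

theorem NSpace.inner_eq (F F' : G.NSpace m) :
    inner ℝ F F' = G.energyBilin (G.fn m F) (G.fn m F') + inner ℝ (G.toL2 m F) (G.toL2 m F') :=
  rfl

theorem NSpace.norm_sq_eq (F : G.NSpace m) :
    ‖F‖ ^ 2 = G.energyBilin (G.fn m F) (G.fn m F) + ‖G.toL2 m F‖ ^ 2 :=
  (G.neumannForm_isForm m).norm_sq_eq F

theorem energy_add_eLpNorm_sq (F : G.NSpace m) :
    G.energy (G.fn m F) + eLpNorm (G.fn m F) 2 m ^ 2 = ENNReal.ofReal (‖F‖ ^ 2) := by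
  rw [NSpace.norm_sq_eq, ENNReal.ofReal_add (fn_finEnergy F).energyBilin_self_nonneg
    (sq_nonneg _), (fn_finEnergy F).energy_eq_ofReal, ENNReal.ofReal_pow (norm_nonneg _),
    ofReal_norm, Lp.enorm_def, fn_eq_coe]

/-- The composition of an element of the Neumann space with a normal contraction. -/
def contract {C : ℝ → ℝ} (hC : LipschitzWith 1 C) (hC0 : C 0 = 0) (F : G.NSpace m) : G.NSpace m :=
  toN (comp_mem_neumannDom (fn_mem F) hC hC0)

@[simp]
theorem fn_contract {C : ℝ → ℝ} (hC : LipschitzWith 1 C) (hC0 : C 0 = 0) (F : G.NSpace m) :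
    G.fn m (contract hC hC0 F) = C ∘ G.fn m F := fn_toN _

theorem toL2_contract {C : ℝ → ℝ} (hC : LipschitzWith 1 C) (hC0 : C 0 = 0) (F : G.NSpace m) :
    G.toL2 m (contract hC hC0 F) = hC.compLp hC0 (G.toL2 m F) := by
  refine Lp.ext (Eventually.of_forall fun x => ?_)
  rw [coe_compLp]
  exact congrFun (fn_contract hC hC0 F) x

theorem norm_contract_le {C : ℝ → ℝ} (hC : LipschitzWith 1 C) (hC0 : C 0 = 0) (F : G.NSpace m) :
    ‖contract hC hC0 F‖ ≤ ‖F‖ := by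
  refine le_of_sq_le_sq ?_ (norm_nonneg F)
  rw [NSpace.norm_sq_eq, NSpace.norm_sq_eq, fn_contract, toL2_contract]
  have hnorm : ‖hC.compLp hC0 (G.toL2 m F)‖ ≤ ‖G.toL2 m F‖ := by
    simpa using hC.norm_compLp_le hC0 (G.toL2 m F)
  exact add_le_add ((fn_finEnergy F).energyBilin_comp_le hC hC0)
    (pow_le_pow_left₀ (norm_nonneg _) hnorm 2)

/-- The absolute value of an element of the Neumann space. -/
def absN (F : G.NSpace m) : G.NSpace m :=
  contract (C := fun t => |t|) lipschitzWith_one_norm abs_zero F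

@[simp]
theorem fn_absN (F : G.NSpace m) (x : X) : G.fn m (absN F) x = |G.fn m F x| :=
  congrFun (fn_contract _ _ F) x

theorem norm_absN_le (F : G.NSpace m) : ‖absN F‖ ≤ ‖F‖ := norm_contract_le _ _ F

variable [MeasurableSingletonClass X]

variable (G m) in
theorem neumannForm_closed : (G.neumannForm m).Closed := by
  refine (G.neumannForm_isForm m).closed_of_val_le_of_tendsto fun u f C _ hf hC => ?_
  have hpt : ∀ x, Tendsto (fun n => G.fn m (u n) x) atTop (𝓝 (f x)) := fun x =>
    ((continuous_coe_apply x).tendsto f).comp hf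
  have hle : G.energy f ≤ ENNReal.ofReal C := energy_le_of_tendsto hpt <| by
    filter_upwards [hC] with n hn
    rw [(fn_finEnergy (u n)).energy_eq_ofReal]
    exact ENNReal.ofReal_le_ofReal hn
  have hfin := G.energy_lt_top_iff.1 (hle.trans_lt ENNReal.ofReal_lt_top)
  obtain ⟨n, hn⟩ := hC.exists
  refine ⟨mem_neumannDom.2 ⟨Lp.memLp f, hfin⟩, (ENNReal.ofReal_le_ofReal_iff
    ((fn_finEnergy (u n)).energyBilin_self_nonneg.trans hn)).1 ?_⟩
  rwa [hfin.energy_eq_ofReal] at hle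

instance : CompleteSpace (G.NSpace m) :=
  (G.neumannForm_isForm m).completeSpace (G.neumannForm_closed m)

theorem continuous_fn_apply (x : X) : Continuous fun F : G.NSpace m => G.fn m F x :=
  (continuous_coe_apply x).comp (G.neumannForm_isForm m).lipschitzWith_toH.continuous

theorem abs_fn_apply_le (F : G.NSpace m) (x : X) : |G.fn m F x| ≤ (√(m.real {x}))⁻¹ * ‖F‖ := by
  have hx := measureReal_singleton_pos m x
  rw [inv_mul_eq_div, le_div_iff₀ (Real.sqrt_pos.2 hx)]
  refine le_of_sq_le_sq ?_ (norm_nonneg F)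
  rw [mul_pow, sq_abs, Real.sq_sqrt hx.le, mul_comm]
  exact (mul_sq_apply_le_norm_sq (G.toL2 m F) x).trans
    (pow_le_pow_left₀ (norm_nonneg _) ((G.neumannForm_isForm m).norm_toH_le F) 2)

variable (G m) in
theorem delta_mem_neumannForm (x : X) : delta m x ∈ (G.neumannForm m).dom := by
  classical
  exact ⟨Lp.memLp _, by rw [coe_delta]; exact G.energy_single_lt_top x⟩

variable (G m) in
/-- The indicator function of a point as an element of the Neumann space. -/
def deltaN (x : X) : G.NSpace m :=
  (G.neumannForm_isForm m).ofDom (delta m x) (G.delta_mem_neumannForm m x)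

theorem fn_deltaN [DecidableEq X] (x : X) : G.fn m (G.deltaN m x) = Pi.single x 1 := coe_delta x

theorem fn_deltaN_mem_bddDom (x : X) : G.fn m (G.deltaN m x) ∈ G.bddDom m := by
  classical
  refine ⟨fn_mem _, 1, fun y => ?_⟩
  rw [fn_deltaN, Pi.single_apply]
  split_ifs <;> norm_num

theorem FinEnergy.energyBilin_delta {f : X → ℝ} (hf : G.FinEnergy f) (x : X) :
    G.energyBilin (delta m x) f = m.real {x} * G.lap m f x := by
  classical
  have hx := (measureReal_singleton_pos m x).ne'
  rw [coe_delta, hf.energyBilin_single, lap]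
  field_simp

theorem inner_deltaN (x : X) (F : G.NSpace m) :
    inner ℝ (G.deltaN m x) F = m.real {x} * (G.lap m (G.fn m F) x + G.fn m F x) := by
  rw [NSpace.inner_eq, deltaN, fn_eq_coe (HForm.IsForm.ofDom _ _ _), HForm.IsForm.toH_ofDom,
    (fn_finEnergy F).energyBilin_delta, inner_delta, ← fn_eq_coe, mul_add]

variable (G m) in
/-- The element of the Neumann space that represents the evaluation at `x`. -/
def evalRepr (x : X) : G.NSpace m :=
  (InnerProductSpace.toDual ℝ _).symm
    ⟨(LinearMap.proj x).comp (G.fn m), continuous_fn_apply x⟩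

theorem inner_evalRepr (F : G.NSpace m) (x : X) : inner ℝ F (G.evalRepr m x) = G.fn m F x := by
  rw [real_inner_comm, evalRepr, InnerProductSpace.toDual_symm_apply]
  rfl

variable (G m) in
theorem dense_span_range_evalRepr :
    Dense (Submodule.span ℝ (range (G.evalRepr m)) : Set (G.NSpace m)) := by
  rw [Submodule.dense_iff_topologicalClosure_eq_top, Submodule.topologicalClosure_eq_top_iff,
    Submodule.eq_bot_iff]
  refine fun F hF => fn_injective (funext fun x => ?_)
  rw [map_zero, Pi.zero_apply, ← inner_evalRepr]
  exact (Submodule.mem_orthogonal' _ _).1 hF _ (Submodule.subset_span ⟨x, rfl⟩)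

end WGraph

/-! ## The Dirichlet space -/

theorem tendsto_inner_of_dense_span {𝕜 E ι : Type*} [RCLike 𝕜] [NormedAddCommGroup E]
    [InnerProductSpace 𝕜 E] {s : Set E} (hs : Dense (Submodule.span 𝕜 s : Set E)) {l : Filter ι}
    {u : ι → E} {f : E} {K : ℝ} (hK : ∀ i, ‖u i‖ ≤ K)
    (h : ∀ v ∈ s, Tendsto (fun i => inner 𝕜 (u i) v) l (𝓝 (inner 𝕜 f v))) (w : E) :
    Tendsto (fun i => inner 𝕜 (u i) w) l (𝓝 (inner 𝕜 f w)) := by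
  have hspan : ∀ v ∈ Submodule.span 𝕜 s,
      Tendsto (fun i => inner 𝕜 (u i) v) l (𝓝 (inner 𝕜 f v)) := by
    intro v hv
    induction hv using Submodule.span_induction with
    | mem v hv => exact h v hv
    | zero => simpa only [inner_zero_right] using tendsto_const_nhds
    | add a b _ _ ha hb => simpa only [inner_add_right] using ha.add hb
    | smul c a _ ha => simpa only [inner_smul_right] using ha.const_mul c
  have hequi : UniformEquicontinuous fun i w => inner 𝕜 (u i) w :=
    LipschitzWith.uniformEquicontinuous _ K.toNNReal fun i => LipschitzWith.of_dist_le_mul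
      fun v w => by
        rw [dist_eq_norm, ← inner_sub_right, dist_eq_norm]
        exact (norm_inner_le_norm _ _).trans
          (mul_le_mul_of_nonneg_right ((hK i).trans K.le_coe_toNNReal) (norm_nonneg _))
  exact (hequi.equicontinuous w).tendsto_of_mem_closure
    ((innerSL 𝕜 f).continuous.tendsto w |>.mono_left nhdsWithin_le_nhds) hspan (hs w)

namespace WGraph

open PosFiniteAtoms

section MaximumPrinciple

variable {X : Type*} [MeasurableSpace X] {G : WGraph X} {m : Measure X} [PosFiniteAtoms m]

theorem eq_zero_of_adj_of_lap_add_eq_zero {h : X → ℝ} (hf : G.FinEnergy h) (h0 : ∀ x, 0 ≤ h x)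
    {x y : X} (hx : h x = 0) (hlap : G.lap m h x + h x = 0) (hxy : 0 < G.b x y) : h y = 0 := by
  have hsum := (hf.summable_b_mul_sub x).hasSum.neg
  have hzero : ∑' y, G.b x y * (h x - h y) = 0 := by
    rw [lap, hx, mul_zero, add_zero, add_zero] at hlap
    rw [hx]
    exact (mul_eq_zero.1 hlap).resolve_left (one_div_ne_zero (measureReal_singleton_pos m x).ne')
  rw [hzero, neg_zero, hx] at hsum
  have hterm := (hasSum_zero_iff_of_nonneg fun z => by
    simpa using mul_nonneg (G.b_nonneg x z) (h0 z)).1 hsum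
  simpa [hxy.ne'] using congrFun hterm y

theorem eq_zero_of_connected (hG : G.Connected) {h : X → ℝ} (hf : G.FinEnergy h)
    (h0 : ∀ x, 0 ≤ h x) (hh : ∀ x, G.lap m h x + h x = 0) {o : X} (ho : h o = 0) : h = 0 := by
  ext x
  induction hG o x with
  | refl => exact ho
  | tail _ hxy ih => exact eq_zero_of_adj_of_lap_add_eq_zero hf h0 ih (hh _) hxy

end MaximumPrinciple

variable {X : Type*} [MeasurableSpace X] [MeasurableSingletonClass X] (G : WGraph X)
  (m : Measure X) [PosFiniteAtoms m]

/-- The finitely supported functions as a subspace of the Neumann space. -/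
def finSpace : Submodule ℝ (G.NSpace m) := Submodule.span ℝ (range (G.deltaN m))

/-- The domain of the Dirichlet form as a subspace of the Neumann space: the closure of the finitely
supported functions. -/
def DSpace : Submodule ℝ (G.NSpace m) := (G.finSpace m).topologicalClosure

theorem isClosed_DSpace : IsClosed (G.DSpace m : Set (G.NSpace m)) :=
  Submodule.isClosed_topologicalClosure _

instance : CompleteSpace (G.DSpace m) := (G.isClosed_DSpace m).completeSpace_coe

theorem finSpace_le_DSpace : G.finSpace m ≤ G.DSpace m := Submodule.le_topologicalClosure _

theorem deltaN_mem_DSpace (x : X) : G.deltaN m x ∈ G.DSpace m :=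
  G.finSpace_le_DSpace m (Submodule.subset_span ⟨x, rfl⟩)

variable {G m}

theorem exists_mem_finSpace {φ : X → ℝ} (hφ : φ.support.Finite) :
    ∃ F ∈ G.finSpace m, G.fn m F = φ := by
  classical
  refine ⟨∑ x ∈ hφ.toFinset, φ x • G.deltaN m x, Submodule.sum_mem _ fun x _ =>
    Submodule.smul_mem _ _ (Submodule.subset_span ⟨x, rfl⟩), ?_⟩
  ext y
  simp only [map_sum, map_smul, fn_deltaN, Finset.sum_apply, Pi.smul_apply, smul_eq_mul,
    Pi.single_apply, mul_ite, mul_one, mul_zero, Finset.sum_ite_eq, Finite.mem_toFinset,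
    Function.mem_support, ite_not, ite_eq_right_iff]
  exact Eq.symm

theorem mem_finSpace_iff {F : G.NSpace m} : F ∈ G.finSpace m ↔ (G.fn m F).support.Finite := by
  classical
  refine ⟨fun hF => ?_, fun hF => ?_⟩
  · induction hF using Submodule.span_induction with
    | mem k hk =>
      obtain ⟨x, rfl⟩ := hk
      rw [fn_deltaN]
      exact (finite_singleton x).subset Pi.support_single_subset
    | zero => simp
    | add a b _ _ ha hb =>
      rw [map_add]
      exact (ha.union hb).subset (Function.support_add _ _)
    | smul c a _ ha =>
      rw [map_smul]
      exact ha.subset (Function.support_const_smul_subset c _)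
  · obtain ⟨F', hF', h⟩ := exists_mem_finSpace (G := G) (m := m) hF
    rwa [← fn_injective h]

theorem mem_finSpace_of_forall_eq_zero {F F' : G.NSpace m} (hF : F ∈ G.finSpace m)
    (h : ∀ x, G.fn m F x = 0 → G.fn m F' x = 0) : F' ∈ G.finSpace m :=
  mem_finSpace_iff.2 ((mem_finSpace_iff.1 hF).subset fun x hx h0 => hx (h x h0))

theorem fn_mem_dirichletDom_iff {F : G.NSpace m} :
    G.fn m F ∈ G.dirichletDom m ↔ F ∈ G.DSpace m := by
  have hdist : ∀ φ : G.NSpace m, G.energy (G.fn m F - G.fn m φ) +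
      eLpNorm (G.fn m F - G.fn m φ) 2 m ^ 2 = ENNReal.ofReal (dist F φ ^ 2) := fun φ => by
    rw [← map_sub, energy_add_eLpNorm_sq, dist_eq_norm]
  have hclosure : F ∈ G.DSpace m ↔ ∀ ε > 0, ∃ φ ∈ G.finSpace m, dist F φ < ε :=
    Metric.mem_closure_iff
  rw [hclosure]
  refine ⟨fun h ε hε => ?_, fun h => ⟨fn_mem F, fun ε hε => ?_⟩⟩
  · obtain ⟨_, hsupp, hlt⟩ := h.2 (ENNReal.ofReal (ε ^ 2)) (ENNReal.ofReal_pos.2 (by positivity))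
    obtain ⟨φ, hφ, rfl⟩ := exists_mem_finSpace (G := G) (m := m) hsupp
    rw [hdist, ENNReal.ofReal_lt_ofReal_iff (by positivity)] at hlt
    exact ⟨φ, hφ, lt_of_pow_lt_pow_left₀ 2 hε.le hlt⟩
  · obtain ⟨r, hr, hrε⟩ := ENNReal.lt_iff_exists_nnreal_btwn.1 hε
    obtain ⟨φ, hφ, hlt⟩ := h (√r) (Real.sqrt_pos.2 (by exact_mod_cast hr))
    refine ⟨G.fn m φ, mem_finSpace_iff.1 hφ, lt_of_le_of_lt ?_ hrε⟩
    rw [hdist, ← ENNReal.ofReal_coe_nnreal]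
    exact ENNReal.ofReal_le_ofReal ((Real.lt_sqrt dist_nonneg).1 hlt).le

theorem mem_dirichletDom_iff {f : X → ℝ} :
    f ∈ G.dirichletDom m ↔ ∃ F ∈ G.DSpace m, G.fn m F = f := by
  constructor
  · intro h
    exact ⟨toN h.1, fn_mem_dirichletDom_iff.1 (by rwa [fn_toN]), fn_toN h.1⟩
  · rintro ⟨F, hF, rfl⟩
    exact fn_mem_dirichletDom_iff.2 hF

theorem mem_DSpace_of_tendsto {ι : Type*} {l : Filter ι} [l.NeBot] {U : ι → G.NSpace m}
    {F : G.NSpace m} {K : ℝ} (hU : ∀ i, U i ∈ G.DSpace m) (hK : ∀ i, ‖U i‖ ≤ K)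
    (h : ∀ x, Tendsto (fun i => G.fn m (U i) x) l (𝓝 (G.fn m F x))) : F ∈ G.DSpace m := by
  rw [← Submodule.orthogonal_orthogonal (G.DSpace m), Submodule.mem_orthogonal']
  intro w hw
  refine tendsto_nhds_unique (tendsto_inner_of_dense_span (G.dense_span_range_evalRepr m) hK
    (by rintro _ ⟨x, rfl⟩; simpa only [inner_evalRepr] using h x) w) ?_
  simp only [(Submodule.mem_orthogonal _ _).1 hw _ (hU _)]
  exact tendsto_const_nhds

theorem exists_seq_finSpace {F : G.NSpace m} (hF : F ∈ G.DSpace m) :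
    ∃ (φ : ℕ → G.NSpace m) (K : ℝ), (∀ n, φ n ∈ G.finSpace m) ∧ (∀ n, ‖φ n‖ ≤ K) ∧
      ∀ x, Tendsto (fun n => G.fn m (φ n) x) atTop (𝓝 (G.fn m F x)) := by
  obtain ⟨φ, hφ, hlim⟩ := mem_closure_iff_seq_limit.1 hF
  obtain ⟨K, hK⟩ := (Metric.isBounded_range_of_tendsto φ hlim).exists_norm_le
  exact ⟨φ, K, hφ, fun n => hK _ ⟨n, rfl⟩, fun x => ((continuous_fn_apply x).tendsto F).comp hlim⟩

theorem contract_mem_DSpace {C : ℝ → ℝ} (hC : LipschitzWith 1 C) (hC0 : C 0 = 0)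
    {F : G.NSpace m} (hF : F ∈ G.DSpace m) : contract hC hC0 F ∈ G.DSpace m := by
  obtain ⟨φ, K, hφ, hK, hlim⟩ := exists_seq_finSpace hF
  refine mem_DSpace_of_tendsto (l := atTop) (U := fun n => contract hC hC0 (φ n)) (fun n => ?_)
    (fun n => (norm_contract_le hC hC0 _).trans (hK n)) fun x => ?_
  · exact G.finSpace_le_DSpace m
      (mem_finSpace_of_forall_eq_zero (hφ n) fun x hx => by simp [hx, hC0])
  · simp only [fn_contract]
    exact (hC.continuous.tendsto _).comp (hlim x)

theorem mem_DSpace_of_abs_le {F W : G.NSpace m} (hW : W ∈ G.DSpace m)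
    (h : ∀ x, |G.fn m F x| ≤ G.fn m W x) : F ∈ G.DSpace m := by
  obtain ⟨φ, K, hφ, hK, hlim⟩ := exists_seq_finSpace hW
  refine mem_DSpace_of_tendsto (K := 2⁻¹ * (‖F‖ + K + (‖F‖ + K))) (l := atTop)
    (U := fun n => (2⁻¹ : ℝ) • (absN (F + φ n) - absN (F - φ n))) (fun n => ?_)
    (fun n => ?_) fun x => ?_
  · exact G.finSpace_le_DSpace m (mem_finSpace_of_forall_eq_zero (hφ n) fun x hx => by simp [hx])
  · rw [norm_smul, norm_inv, Real.norm_two]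
    refine mul_le_mul_of_nonneg_left ((norm_sub_le _ _).trans (add_le_add ?_ ?_)) (by norm_num)
    · exact (norm_absN_le _).trans ((norm_add_le _ _).trans (by linarith [hK n]))
    · exact (norm_absN_le _).trans ((norm_sub_le _ _).trans (by linarith [hK n]))
  · have hF : G.fn m F x = 2⁻¹ * (|G.fn m F x + G.fn m W x| - |G.fn m F x - G.fn m W x|) := by
      obtain ⟨hlo, hhi⟩ := abs_le.1 (h x)
      rw [abs_of_nonneg (by linarith), abs_of_nonpos (by linarith)]
      ring
    rw [hF]
    simp only [map_smul, map_sub, fn_absN, map_add, Pi.smul_apply, Pi.sub_apply, Pi.add_apply,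
      smul_eq_mul]
    exact ((tendsto_const_nhds.add (hlim x)).abs.sub
      (tendsto_const_nhds.sub (hlim x)).abs).const_mul _

/-! ## The orthogonal complement of the Dirichlet space -/

theorem lap_add_eq_zero_of_mem_orthogonal {F : G.NSpace m} (hF : F ∈ (G.DSpace m)ᗮ) (x : X) :
    G.lap m (G.fn m F) x + G.fn m F x = 0 := by
  have h := (Submodule.mem_orthogonal _ _).1 hF _ (G.deltaN_mem_DSpace m x)
  rw [inner_deltaN] at h
  exact (mul_eq_zero.1 h).resolve_left (measureReal_singleton_pos m x).ne'

theorem absN_eq_self_of_mem_orthogonal {H : G.NSpace m} (hH : H ∈ (G.DSpace m)ᗮ)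
    (h : absN H - H ∈ G.DSpace m) : absN H = H := by
  have horth : inner ℝ H (absN H - H) = 0 := (Submodule.mem_orthogonal' _ _).1 hH _ h
  have hnorm : ‖absN H‖ ^ 2 = ‖H‖ ^ 2 + ‖absN H - H‖ ^ 2 := by
    rw [← add_sub_cancel H (absN H), norm_add_sq_real, add_sub_cancel, horth, mul_zero, add_zero]
  have hle := pow_le_pow_left₀ (norm_nonneg _) (norm_absN_le H) 2
  have hzero : ‖absN H - H‖ ^ 2 = 0 := le_antisymm (by linarith) (sq_nonneg _)
  exact sub_eq_zero.1 (norm_eq_zero.1 (sq_eq_zero_iff.1 hzero))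

theorem fn_nonneg_of_mem_orthogonal {P H : G.NSpace m} (hP : P ∈ G.DSpace m)
    (hH : H ∈ (G.DSpace m)ᗮ) (h : ∀ x, 0 ≤ G.fn m (P + H) x) (x : X) : 0 ≤ G.fn m H x := by
  suffices absN H = H by
    rw [← this, fn_absN]
    exact abs_nonneg _
  refine absN_eq_self_of_mem_orthogonal hH (mem_DSpace_of_abs_le (W := (2 : ℝ) • absN P)
    (Submodule.smul_mem _ _ (contract_mem_DSpace _ _ hP)) fun y => ?_)
  have hy := h y
  simp only [map_add, map_sub, map_smul, Pi.add_apply, Pi.sub_apply, Pi.smul_apply, fn_absN,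
    smul_eq_mul] at hy ⊢
  rw [abs_of_nonneg (sub_nonneg.2 (le_abs_self _))]
  rcases abs_cases (G.fn m H y) with hcase | hcase <;>
    linarith [le_abs_self (G.fn m P y), abs_nonneg (G.fn m P y)]

end WGraph

/-! ## Absolute values and truncations -/

theorem ereal_abs_eq_max_toENNReal (x : EReal) : x.abs = max x.toENNReal (-x).toENNReal := by
  induction x with
  | bot => simp
  | coe r =>
    rw [EReal.abs_def, ← EReal.coe_neg, EReal.toENNReal_of_ne_top (EReal.coe_ne_top _),
      EReal.toENNReal_of_ne_top (EReal.coe_ne_top _), EReal.toReal_coe, EReal.toReal_coe,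
      ← ENNReal.ofReal_max, abs]
  | top => simp

theorem continuous_ereal_abs : Continuous EReal.abs := by
  rw [funext ereal_abs_eq_max_toENNReal]
  exact EReal.continuous_toENNReal.max (EReal.continuous_toENNReal.comp continuous_neg)

theorem ereal_coe_toReal_of_abs_ne_top {x : EReal} (h : x.abs ≠ ∞) : (x.toReal : EReal) = x := by
  refine EReal.coe_toReal ?_ ?_ <;> rintro rfl <;> simp at h

theorem ofReal_abs_toReal_of_abs_ne_top {x : EReal} (h : x.abs ≠ ∞) :
    ENNReal.ofReal |x.toReal| = x.abs := by
  rw [← EReal.abs_def, ereal_coe_toReal_of_abs_ne_top h]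

/-- Truncation of the real line to the interval `[-K, K]`. -/
def clamp (K t : ℝ) : ℝ := max (-K) (min K t)

theorem lipschitzWith_clamp (K : ℝ) : LipschitzWith 1 (clamp K) :=
  (LipschitzWith.id.const_min K).const_max (-K)

theorem monotone_clamp (K : ℝ) : Monotone (clamp K) := fun _ _ h =>
  max_le_max le_rfl (min_le_min le_rfl h)

theorem abs_clamp_le {K : ℝ} (hK : 0 ≤ K) (t : ℝ) : |clamp K t| ≤ K :=
  abs_le.2 ⟨le_max_left _ _, max_le (by linarith) (min_le_left _ _)⟩

theorem clamp_eq_self {K t : ℝ} (h : |t| ≤ K) : clamp K t = t := by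
  rw [clamp, min_eq_right (abs_le.1 h).2, max_eq_right (abs_le.1 h).1]

theorem clamp_zero {K : ℝ} (hK : 0 ≤ K) : clamp K 0 = 0 := clamp_eq_self (abs_zero.trans_le hK)

/-- Soft thresholding at height `ε`: it shrinks every number by `ε` towards `0`. -/
def softThreshold (ε t : ℝ) : ℝ := t - clamp ε t

theorem lipschitzWith_softThreshold (ε : ℝ) : LipschitzWith 1 (softThreshold ε) := by
  refine LipschitzWith.of_le_add fun s t => ?_
  have hdist := (lipschitzWith_clamp ε).dist_le_mul t s
  rw [NNReal.coe_one, one_mul, Real.dist_eq, Real.dist_eq] at hdist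
  rw [softThreshold, softThreshold, Real.dist_eq]
  rcases le_total s t with hst | hst
  · rw [abs_of_nonneg (sub_nonneg.2 hst)] at hdist
    rw [abs_of_nonpos (sub_nonpos.2 hst)]
    linarith [le_abs_self (clamp ε t - clamp ε s)]
  · rw [abs_of_nonneg (sub_nonneg.2 hst)]
    linarith [monotone_clamp ε hst]

theorem softThreshold_eq_zero {ε t : ℝ} (h : |t| ≤ ε) : softThreshold ε t = 0 := by
  rw [softThreshold, clamp_eq_self h, sub_self]

theorem softThreshold_zero {ε : ℝ} (hε : 0 ≤ ε) : softThreshold ε 0 = 0 :=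
  softThreshold_eq_zero (abs_zero.trans_le hε)

theorem abs_softThreshold_sub_le {ε : ℝ} (hε : 0 ≤ ε) (t : ℝ) : |softThreshold ε t - t| ≤ ε := by
  rw [softThreshold, sub_sub_cancel_left, abs_neg]
  exact abs_clamp_le hε t

theorem abs_softThreshold_le {ε : ℝ} (hε : 0 ≤ ε) (t : ℝ) : |softThreshold ε t| ≤ |t| := by
  simpa [Real.dist_eq, softThreshold_zero hε] using (lipschitzWith_softThreshold ε).dist_le_mul t 0

theorem tendsto_clamp_softThreshold (t : ℝ) :
    Tendsto (fun n : ℕ => clamp n (softThreshold (1 / ((n : ℝ) + 1)) t)) atTop (𝓝 t) := by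
  have hpos : ∀ n : ℕ, (0 : ℝ) ≤ 1 / ((n : ℝ) + 1) := fun n => by positivity
  have hsoft : Tendsto (fun n : ℕ => softThreshold (1 / ((n : ℝ) + 1)) t) atTop (𝓝 t) :=
    tendsto_iff_norm_sub_tendsto_zero.2 (squeeze_zero (fun _ => norm_nonneg _)
      (fun n => abs_softThreshold_sub_le (hpos n) t) tendsto_one_div_add_atTop_nhds_zero_nat)
  refine hsoft.congr' ?_
  filter_upwards [eventually_ge_atTop ⌈|t|⌉₊] with n hn
  exact (clamp_eq_self ((abs_softThreshold_le (hpos n) t).trans (Nat.ceil_le.1 hn))).symm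

/-! ## Boundary values -/

namespace WGraph

open PosFiniteAtoms

section Extension

variable {X : Type*} [MeasurableSpace X] (G : WGraph X) (m : Measure X)

/-- The trace on `X` of the neighbourhoods of a point of `X̂`. -/
def nhdsIn (p : G.Hat m) : Filter X := comap (G.incl m) (𝓝 p)

instance (p : G.Hat m) : (G.nhdsIn m p).NeBot :=
  comap_neBot fun t ht => by
    obtain ⟨_, hq, x, rfl⟩ := mem_closure_iff_nhds.1 (G.denseRange_incl m p) t ht
    exact ⟨x, hq⟩

variable {G m} {f g : X → ℝ}

theorem tendsto_ext (hf : f ∈ G.neumannDom m) (p : G.Hat m) :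
    Tendsto (fun x => (f x : EReal)) (G.nhdsIn m p) (𝓝 (G.ext m f p)) :=
  (((G.continuous_ext m hf).tendsto p).comp tendsto_comap).congr fun x => G.ext_incl m hf x

theorem tendsto_bddExt (f : G.bddDom m) (p : G.Hat m) :
    Tendsto (f : X → ℝ) (G.nhdsIn m p) (𝓝 (G.bddExt m f p)) :=
  ((G.continuous_bddExt m f).tendsto p).comp tendsto_comap

theorem continuous_abs_ext (hf : f ∈ G.neumannDom m) :
    Continuous fun p => (G.ext m f p).abs :=
  continuous_ereal_abs.comp (G.continuous_ext m hf)

theorem tendsto_abs_ext (hf : f ∈ G.neumannDom m) (p : G.Hat m) :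
    Tendsto (fun x => ENNReal.ofReal |f x|) (G.nhdsIn m p) (𝓝 (G.ext m f p).abs) :=
  (continuous_ereal_abs.tendsto _).comp (tendsto_ext hf p)

theorem tendsto_toReal_ext (hf : f ∈ G.neumannDom m) {p : G.Hat m}
    (h : (G.ext m f p).abs ≠ ∞) : Tendsto f (G.nhdsIn m p) (𝓝 (G.ext m f p).toReal) := by
  have hlim := tendsto_ext hf p
  rw [← ereal_coe_toReal_of_abs_ne_top h] at hlim
  exact EReal.tendsto_coe.1 hlim

theorem tendsto_zero_of_ext_eq_zero (hf : f ∈ G.neumannDom m) {p : G.Hat m}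
    (h : G.ext m f p = 0) : Tendsto f (G.nhdsIn m p) (𝓝 0) := by
  have hlim := tendsto_ext hf p
  rw [h] at hlim
  exact EReal.tendsto_coe.1 hlim

theorem ext_eq_of_tendsto (hf : f ∈ G.neumannDom m) {p : G.Hat m} {a : ℝ}
    (h : Tendsto f (G.nhdsIn m p) (𝓝 a)) : G.ext m f p = a :=
  tendsto_nhds_unique (tendsto_ext hf p) (EReal.tendsto_coe.2 h)

theorem ext_eq_zero_of_tendsto_arctan (hf : f ∈ G.neumannDom m) {p : G.Hat m}
    (h : Tendsto (fun x => Real.arctan (f x)) (G.nhdsIn m p) (𝓝 0)) : G.ext m f p = 0 := by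
  have htan := (Real.continuousAt_tan.2 (by simp : Real.cos 0 ≠ 0)).tendsto.comp h
  simp only [Function.comp_def, Real.tan_arctan, Real.tan_zero] at htan
  exact ext_eq_of_tendsto hf htan

theorem abs_ext_le_of_abs_le (hf : f ∈ G.neumannDom m) (hg : g ∈ G.neumannDom m)
    (h : ∀ x, |f x| ≤ |g x|) (p : G.Hat m) : (G.ext m f p).abs ≤ (G.ext m g p).abs :=
  le_of_tendsto_of_tendsto' (tendsto_abs_ext hf p) (tendsto_abs_ext hg p) fun x =>
    ENNReal.ofReal_le_ofReal (h x)

theorem abs_ext_add_le (hf : f ∈ G.neumannDom m) (hg : g ∈ G.neumannDom m) (p : G.Hat m) :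
    (G.ext m (f + g) p).abs ≤ (G.ext m f p).abs + (G.ext m g p).abs :=
  le_of_tendsto_of_tendsto' (tendsto_abs_ext (add_mem_neumannDom hf hg) p)
    ((tendsto_abs_ext hf p).add (tendsto_abs_ext hg p)) fun x => by
      rw [← ENNReal.ofReal_add (abs_nonneg _) (abs_nonneg _)]
      exact ENNReal.ofReal_le_ofReal (abs_add_le _ _)

theorem abs_ext_smul (hf : f ∈ G.neumannDom m) (a : ℝ) (p : G.Hat m) :
    (G.ext m (a • f) p).abs = ENNReal.ofReal |a| * (G.ext m f p).abs := by
  refine tendsto_nhds_unique (tendsto_abs_ext (smul_mem_neumannDom hf a) p) ?_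
  refine (ENNReal.Tendsto.const_mul (tendsto_abs_ext hf p) (Or.inr ENNReal.ofReal_ne_top)).congr
    fun x => ?_
  rw [← ENNReal.ofReal_mul (abs_nonneg a), ← abs_mul, Pi.smul_apply, smul_eq_mul]

end Extension

variable {X : Type*} [MeasurableSpace X] [MeasurableSingletonClass X] {G : WGraph X}
  {m : Measure X} [PosFiniteAtoms m]

theorem trace_eq_zero_of_mem_DSpace {F : G.NSpace m} (hF : F ∈ G.DSpace m) (z : G.Bdry m) :
    G.trace m (G.fn m F) z = 0 := by
  have hmem : G.fn m (contract lipschitzWith_arctan Real.arctan_zero F) ∈ G.dirichletDom m :=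
    fn_mem_dirichletDom_iff.2 (contract_mem_DSpace _ _ hF)
  rw [fn_contract] at hmem
  have hlim := tendsto_bddExt ⟨_, G.arctan_mem_bddDom m (fn_mem F)⟩ z.1
  rw [z.2.2 _ hmem] at hlim
  exact ext_eq_zero_of_tendsto_arctan (fn_mem F) hlim

theorem exists_bddExt_ne_zero_of_ext_ne_zero {f : X → ℝ} (h : ∀ z, G.trace m f z = 0)
    {p : G.Hat m} (hp : G.ext m f p ≠ 0) :
    ∃ g : G.bddDom m, (g : X → ℝ) ∈ G.dirichletDom m ∧ G.bddExt m g p ≠ 0 := by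
  classical
  by_cases hpr : p ∈ range (G.incl m)
  · obtain ⟨x, rfl⟩ := hpr
    refine ⟨⟨_, fn_deltaN_mem_bddDom x⟩, fn_mem_dirichletDom_iff.2 (G.deltaN_mem_DSpace m x), ?_⟩
    simp [bddExt_incl, fn_deltaN]
  · by_contra! hcon
    exact hp (h ⟨p, hpr, hcon⟩)

theorem exists_mem_DSpace_one_le_of_isCompact {K : Set (G.Hat m)} (hK : IsCompact K)
    (h : ∀ p ∈ K, ∃ g : G.bddDom m, (g : X → ℝ) ∈ G.dirichletDom m ∧ G.bddExt m g p ≠ 0) :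
    ∃ W ∈ G.DSpace m, (∀ x, 0 ≤ G.fn m W x) ∧ ∀ x, G.incl m x ∈ K → 1 ≤ G.fn m W x := by
  refine hK.induction_on (p := fun s => ∃ W ∈ G.DSpace m, (∀ x, 0 ≤ G.fn m W x) ∧
    ∀ x, G.incl m x ∈ s → 1 ≤ G.fn m W x) ⟨0, Submodule.zero_mem _, by simp, by simp⟩
    (fun s t hst ⟨W, hW, h0, h1⟩ => ⟨W, hW, h0, fun x hx => h1 x (hst hx)⟩) ?_ fun p hp => ?_
  · rintro s t ⟨W, hW, h0, h1⟩ ⟨W', hW', h0', h1'⟩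
    refine ⟨W + W', Submodule.add_mem _ hW hW', fun x => ?_, fun x hx => ?_⟩
    · rw [map_add]
      exact add_nonneg (h0 x) (h0' x)
    · rw [map_add, Pi.add_apply]
      rcases hx with hx | hx
      · linarith [h1 x hx, h0' x]
      · linarith [h1' x hx, h0 x]
  · obtain ⟨g, hgD, hg⟩ := h p hp
    obtain ⟨F, hF, hFg⟩ := mem_dirichletDom_iff.1 hgD
    have ha := abs_pos.2 hg
    set a := |G.bddExt m g p|
    refine ⟨{q | a / 2 < |G.bddExt m g q|}, mem_nhdsWithin_of_mem_nhds
      ((isOpen_lt continuous_const (G.continuous_bddExt m g).abs).mem_nhds (half_lt_self ha)),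
      (2 / a) • absN F, Submodule.smul_mem _ _ (contract_mem_DSpace _ _ hF), fun y => ?_,
      fun y (hy : a / 2 < |G.bddExt m g (G.incl m y)|) => ?_⟩
    · rw [map_smul, Pi.smul_apply, fn_absN]
      exact mul_nonneg (by positivity) (abs_nonneg _)
    · rw [G.bddExt_incl] at hy
      rw [map_smul, Pi.smul_apply, fn_absN, hFg, smul_eq_mul, div_mul_eq_mul_div, le_div_iff₀ ha]
      linarith

theorem exists_mem_DSpace_one_le {f : X → ℝ} (hf : f ∈ G.neumannDom m)
    (h : ∀ z, G.trace m f z = 0) {ε : ℝ} (hε : 0 < ε) :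
    ∃ W ∈ G.DSpace m, (∀ x, 0 ≤ G.fn m W x) ∧ ∀ x, ε ≤ |f x| → 1 ≤ G.fn m W x := by
  have hcpt : IsCompact {p : G.Hat m | ENNReal.ofReal ε ≤ (G.ext m f p).abs} :=
    (isClosed_le continuous_const (continuous_abs_ext hf)).isCompact
  obtain ⟨W, hW, h0, h1⟩ := exists_mem_DSpace_one_le_of_isCompact hcpt fun p hp =>
    exists_bddExt_ne_zero_of_ext_ne_zero h fun h0 =>
      ((ENNReal.ofReal_pos.2 hε).trans_le hp).ne' (EReal.abs_eq_zero_iff.2 h0)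
  refine ⟨W, hW, h0, fun x hx => h1 x ?_⟩
  rw [mem_ofPred_eq, G.ext_incl m hf, EReal.abs_def]
  exact ENNReal.ofReal_le_ofReal hx

theorem mem_DSpace_iff_trace_eq_zero {F : G.NSpace m} :
    F ∈ G.DSpace m ↔ ∀ z, G.trace m (G.fn m F) z = 0 := by
  refine ⟨trace_eq_zero_of_mem_DSpace, fun h => ?_⟩
  have hpos : ∀ n : ℕ, (0 : ℝ) < 1 / ((n : ℝ) + 1) := fun n => by positivity
  refine mem_DSpace_of_tendsto (K := ‖F‖) (l := atTop)
    (U := fun n : ℕ => contract (lipschitzWith_clamp n) (clamp_zero n.cast_nonneg)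
      (contract (lipschitzWith_softThreshold _) (softThreshold_zero (hpos n).le) F))
    (fun n => ?_) (fun n => (norm_contract_le _ _ _).trans (norm_contract_le _ _ _)) fun x => ?_
  · obtain ⟨W, hW, h0, h1⟩ := exists_mem_DSpace_one_le (fn_mem F) h (hpos n)
    refine mem_DSpace_of_abs_le (W := (n : ℝ) • W) (Submodule.smul_mem _ _ hW) fun x => ?_
    simp only [fn_contract, Function.comp_apply, map_smul, Pi.smul_apply, smul_eq_mul]
    rcases le_total (1 / ((n : ℝ) + 1)) |G.fn m F x| with hx | hx
    · exact (abs_clamp_le n.cast_nonneg _).trans (le_mul_of_one_le_right n.cast_nonneg (h1 x hx))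
    · rw [softThreshold_eq_zero hx, clamp_zero n.cast_nonneg, abs_zero]
      exact mul_nonneg n.cast_nonneg (h0 x)
  · simp only [fn_contract]
    exact tendsto_clamp_softThreshold _

theorem mem_dirichletDom_iff_trace {f : X → ℝ} :
    f ∈ G.dirichletDom m ↔ f ∈ G.neumannDom m ∧ ∀ z, G.trace m f z = 0 := by
  constructor
  · intro h
    obtain ⟨F, hF, rfl⟩ := mem_dirichletDom_iff.1 h
    exact ⟨fn_mem F, trace_eq_zero_of_mem_DSpace hF⟩
  · rintro ⟨hf, h⟩
    refine mem_dirichletDom_iff.2 ⟨toN hf, mem_DSpace_iff_trace_eq_zero.2 ?_, fn_toN hf⟩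
    rwa [fn_toN]

end WGraph

/-! ## The Dirichlet and the Neumann Laplacian -/

namespace WGraph

open PosFiniteAtoms

variable {X : Type*} [MeasurableSpace X] {G : WGraph X} {m : Measure X}

theorem FinEnergy.normalFunctional_add_eq_zero_iff {f g : X → ℝ} (hf : G.FinEnergy f)
    (hg : G.FinEnergy g) (t : ℝ) : G.normalFunctional m f g + t = 0 ↔
      G.energyBilin g f + t = ∫ x, g x * G.lap m f x ∂m := by
  rw [normalFunctional, hf.energyBilin_comm hg, sub_add_eq_add_sub, sub_eq_zero]
  simp only [mul_comm]

variable [MeasurableSingletonClass X] [PosFiniteAtoms m]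

theorem exists_lapRestriction {Q : HForm (Lp ℝ 2 m)} (hQ : Q.IsForm) (hc : Q.Closed)
    (hd : ∀ x, delta m x ∈ Q.dom)
    (hval : ∀ x, ∀ f ∈ Q.dom, Q.val (delta m x) f = m.real {x} * G.lap m f x)
    {D : Set (X → ℝ)} (hD : ∀ f : Lp ℝ 2 m, (f : X → ℝ) ∈ D ↔ f ∈ Q.dom ∧
      MemLp (G.lap m f) 2 m ∧ ∀ g ∈ Q.dom, Q.val g f = ∫ x, g x * G.lap m f x ∂m) :
    ∃ L : Lp ℝ 2 m →ₗ.[ℝ] Lp ℝ 2 m, HForm.IsOperatorOf L Q ∧ G.IsLapRestriction m L D := by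
  have hdense := dense_dom_of_delta_mem hQ hd
  have hlap : ∀ f ∈ Q.dom, ∀ v : Lp ℝ 2 m, (∀ g ∈ Q.dom, Q.val g f = inner ℝ g v) →
      (v : X → ℝ) = G.lap m f := fun f hf v hv => funext fun x => by
    have h := hv _ (hd x)
    rw [hval x f hf, inner_delta] at h
    exact (mul_left_cancel₀ (measureReal_singleton_pos m x).ne' h).symm
  refine ⟨hQ.operator, hQ.isOperatorOf_operator hc hdense, fun f => ?_, fun f =>
    congrFun (hlap f (hQ.operator_domain_subset f.2) _ fun g => hQ.val_eq_inner_operator hdense f)⟩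
  rw [hQ.mem_operator_domain_iff, hD]
  refine and_congr_right fun hf => ⟨?_, ?_⟩
  · rintro ⟨v, hv⟩
    have hvf := hlap f hf v hv
    exact ⟨hvf ▸ Lp.memLp v, fun g hg => by rw [hv g hg, l2_inner_eq_integral, hvf]⟩
  · rintro ⟨hmem, h⟩
    exact ⟨hmem.toLp _, fun g hg => by rw [h g hg, l2_inner_eq_integral, coe_toLp]⟩

theorem exists_neumannLaplacian :
    ∃ L : Lp ℝ 2 m →ₗ.[ℝ] Lp ℝ 2 m, HForm.IsOperatorOf L (G.neumannForm m) ∧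
      G.IsLapRestriction m L {f | f ∈ G.neumannDom m ∧ MemLp (G.lap m f) 2 m ∧
        ∀ g ∈ G.neumannDom m, G.normalFunctional m f g = 0} := by
  refine exists_lapRestriction (G.neumannForm_isForm m) (G.neumannForm_closed m)
    (G.delta_mem_neumannForm m) (fun x f hf => (mem_neumannDom.1 hf).2.energyBilin_delta x)
    fun f => and_congr_right fun hf => and_congr_right fun _ => ?_
  refine Iff.trans ?_ (forall_coe_iff (P := fun g => g ∈ G.neumannDom m →
    G.energyBilin g f = ∫ x, g x * G.lap m f x ∂m)).symm
  refine forall_congr' fun g => ?_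
  have key (hg : g ∈ G.neumannDom m) := by
    simpa only [add_zero] using (mem_neumannDom.1 hf).2.normalFunctional_add_eq_zero_iff (m := m)
      (mem_neumannDom.1 hg).2 0
  exact ⟨fun h _ hg => (key hg).1 (h hg), fun h hg => (key hg).2 (h hg.1 hg)⟩

variable (G m) in
theorem dirichletForm_eq_restrict :
    G.dirichletForm m = (G.neumannForm_isForm m).restrict (G.DSpace m) := by
  refine congrArg (HForm.mk · _) (Set.ext fun f => mem_dirichletDom_iff.trans ?_)
  refine exists_congr fun F => and_congr_right fun _ => ⟨fun h => ?_, fun h => h ▸ rfl⟩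
  exact Lp.ext (Eventually.of_forall (congrFun h))

theorem energyBilin_eq_integral_of_mem_DSpace {F F' : G.NSpace m} (hF : F ∈ G.DSpace m)
    (hF' : MemLp (G.lap m (G.fn m F')) 2 m) :
    G.energyBilin (G.fn m F) (G.fn m F') = ∫ x, G.fn m F x * G.lap m (G.fn m F') x ∂m := by
  set v := hF'.toLp _ with hv
  have hfin : EqOn (innerₛₗ ℝ F') ((innerₛₗ ℝ (v + G.toL2 m F')).comp (G.toL2 m))
      (G.finSpace m) := LinearMap.eqOn_span <| by
    rintro _ ⟨x, rfl⟩
    rw [innerₛₗ_apply_apply, LinearMap.comp_apply, innerₛₗ_apply_apply, real_inner_comm,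
      inner_deltaN, deltaN, HForm.IsForm.toH_ofDom, real_inner_comm, inner_delta, coe_add, hv,
      coe_toLp, Pi.add_apply, fn_eq_coe]
  have h : inner ℝ F' F = inner ℝ (v + G.toL2 m F') (G.toL2 m F) := hfin.closure
    (continuous_const.inner continuous_id) (continuous_const.inner
      (G.neumannForm_isForm m).lipschitzWith_toH.continuous) hF
  rw [NSpace.inner_eq, inner_add_left, add_left_inj, real_inner_comm, l2_inner_eq_integral, hv,
    coe_toLp] at h
  rw [(fn_finEnergy F).energyBilin_comm (fn_finEnergy F')]
  exact h

theorem exists_dirichletLaplacian :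
    ∃ L : Lp ℝ 2 m →ₗ.[ℝ] Lp ℝ 2 m, HForm.IsOperatorOf L (G.dirichletForm m) ∧
      G.IsLapRestriction m L {f | f ∈ G.neumannDom m ∧ MemLp (G.lap m f) 2 m ∧
        ∀ z, G.trace m f z = 0} := by
  have hQ := G.neumannForm_isForm m
  rw [dirichletForm_eq_restrict]
  refine exists_lapRestriction (hQ.isForm_restrict _) (hQ.closed_restrict (G.neumannForm_closed m)
    (G.isClosed_DSpace m)) (fun x => ⟨_, G.deltaN_mem_DSpace m x, rfl⟩) ?_ fun f => ⟨?_, ?_⟩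
  · rintro x _ ⟨F, -, rfl⟩
    exact (fn_finEnergy F).energyBilin_delta x
  · rintro ⟨hf, hmem, htr⟩
    obtain ⟨F, hF, hFf⟩ := mem_dirichletDom_iff.1 (mem_dirichletDom_iff_trace.2 ⟨hf, htr⟩)
    obtain rfl : G.toL2 m F = f := Lp.ext (Eventually.of_forall (congrFun hFf))
    refine ⟨⟨F, hF, rfl⟩, hmem, ?_⟩
    rintro _ ⟨F', hF', rfl⟩
    exact energyBilin_eq_integral_of_mem_DSpace hF' hmem
  · rintro ⟨⟨F, hF, rfl⟩, hmem, -⟩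
    exact ⟨fn_mem F, hmem, trace_eq_zero_of_mem_DSpace hF⟩

end WGraph

/-! ## The boundary energy -/

theorem ennreal_add_sq_le (a b : ℝ≥0∞) : (a + b) ^ 2 ≤ 2 * (a ^ 2 + b ^ 2) := by
  have h := ENNReal.rpow_add_le_mul_rpow_add_rpow a b one_le_two
  norm_num at h
  exact_mod_cast h

namespace WGraph

open PosFiniteAtoms

section BoundaryEnergy

variable {X : Type*} [MeasurableSpace X] {G : WGraph X} {m : Measure X}
  {μ : Measure (G.Bdry m)} {β : G.Bdry m → ℝ≥0∞} {f g h : X → ℝ}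

theorem continuous_trace (hf : f ∈ G.neumannDom m) : Continuous (G.trace m f) :=
  (G.continuous_ext m hf).comp continuous_subtype_val

theorem measurable_abs_trace (hf : f ∈ G.neumannDom m) :
    Measurable fun z : G.Bdry m => (G.trace m f z).abs :=
  (continuous_ereal_abs.comp (continuous_trace hf)).measurable

theorem measurable_toReal_trace (hf : f ∈ G.neumannDom m) :
    Measurable fun z : G.Bdry m => (G.trace m f z).toReal :=
  (continuous_trace hf).measurable.ereal_toReal

theorem bdryEnergy_eq_lintegral_withDensity (hβ : Measurable β) (hf : f ∈ G.neumannDom m) :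
    G.bdryEnergy m μ β f = ∫⁻ z, (G.trace m f z).abs ^ 2 ∂(μ.withDensity β) := by
  rw [lintegral_withDensity_eq_lintegral_mul μ hβ ((measurable_abs_trace hf).pow_const 2)]
  exact lintegral_congr fun z => mul_comm _ _

theorem bdryEnergy_eq_zero_of_trace_eq_zero (h : ∀ z, G.trace m f z = 0) :
    G.bdryEnergy m μ β f = 0 := by
  simp [bdryEnergy, h]

theorem bdryEnergy_le_of_abs_le (hf : f ∈ G.neumannDom m) (hg : g ∈ G.neumannDom m)
    (h : ∀ x, |f x| ≤ |g x|) : G.bdryEnergy m μ β f ≤ G.bdryEnergy m μ β g :=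
  lintegral_mono fun z => mul_le_mul_left
    (pow_le_pow_left' (abs_ext_le_of_abs_le hf hg h z.1) 2) _

theorem bdryEnergy_add_lt_top (hβ : Measurable β) (hf : f ∈ G.neumannDom m)
    (hg : g ∈ G.neumannDom m) (ef : G.bdryEnergy m μ β f < ∞) (eg : G.bdryEnergy m μ β g < ∞) :
    G.bdryEnergy m μ β (f + g) < ∞ := by
  rw [bdryEnergy_eq_lintegral_withDensity hβ hf] at ef
  rw [bdryEnergy_eq_lintegral_withDensity hβ hg] at eg
  rw [bdryEnergy_eq_lintegral_withDensity hβ (add_mem_neumannDom hf hg)]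
  calc ∫⁻ z, (G.trace m (f + g) z).abs ^ 2 ∂(μ.withDensity β)
      ≤ ∫⁻ z, 2 * ((G.trace m f z).abs ^ 2 + (G.trace m g z).abs ^ 2) ∂(μ.withDensity β) :=
        lintegral_mono fun z =>
          (pow_le_pow_left' (abs_ext_add_le hf hg z.1) 2).trans (ennreal_add_sq_le _ _)
    _ = 2 * (∫⁻ z, (G.trace m f z).abs ^ 2 ∂(μ.withDensity β) +
          ∫⁻ z, (G.trace m g z).abs ^ 2 ∂(μ.withDensity β)) := by
        rw [lintegral_const_mul' _ _ ENNReal.ofNat_ne_top,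
          lintegral_add_left ((measurable_abs_trace hf).pow_const 2)]
    _ < ∞ := ENNReal.mul_lt_top ENNReal.ofNat_lt_top (ENNReal.add_lt_top.2 ⟨ef, eg⟩)

theorem bdryEnergy_smul (hf : f ∈ G.neumannDom m) (a : ℝ) :
    G.bdryEnergy m μ β (a • f) = ENNReal.ofReal |a| ^ 2 * G.bdryEnergy m μ β f := by
  rw [bdryEnergy, bdryEnergy, ← lintegral_const_mul' _ _ (ENNReal.pow_ne_top ENNReal.ofReal_ne_top)]
  refine lintegral_congr fun z => ?_
  rw [trace, abs_ext_smul hf, mul_pow, mul_assoc, trace]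

theorem ae_abs_trace_ne_top (hβ : Measurable β) (hf : f ∈ G.neumannDom m)
    (h : G.bdryEnergy m μ β f < ∞) : ∀ᵐ z ∂(μ.withDensity β), (G.trace m f z).abs ≠ ∞ := by
  rw [bdryEnergy_eq_lintegral_withDensity hβ hf] at h
  filter_upwards [ae_lt_top ((measurable_abs_trace hf).pow_const 2) h.ne] with z hz htop
  simp [htop] at hz

theorem lintegral_ofReal_sq_toReal_trace (hβ : Measurable β) (hf : f ∈ G.neumannDom m)
    (h : G.bdryEnergy m μ β f < ∞) :
    ∫⁻ z, ENNReal.ofReal ((G.trace m f z).toReal ^ 2) ∂(μ.withDensity β) =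
      G.bdryEnergy m μ β f := by
  rw [bdryEnergy_eq_lintegral_withDensity hβ hf]
  refine lintegral_congr_ae ?_
  filter_upwards [ae_abs_trace_ne_top hβ hf h] with z hz
  rw [← ofReal_abs_toReal_of_abs_ne_top hz, ← ENNReal.ofReal_pow (abs_nonneg _), sq_abs]

theorem memLp_toReal_trace (hβ : Measurable β) (hf : f ∈ G.neumannDom m)
    (h : G.bdryEnergy m μ β f < ∞) :
    MemLp (fun z => (G.trace m f z).toReal) 2 (μ.withDensity β) := by
  have hmeas : AEStronglyMeasurable (fun z => (G.trace m f z).toReal) (μ.withDensity β) :=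
    (measurable_toReal_trace hf).aestronglyMeasurable
  refine (memLp_two_iff_integrable_sq hmeas).2 ⟨hmeas.pow 2, ?_⟩
  rw [hasFiniteIntegral_iff_ofReal (Eventually.of_forall fun z => sq_nonneg _)]
  exact (lintegral_ofReal_sq_toReal_trace hβ hf h).trans_lt h

theorem bdryBilin_self (hβ : Measurable β) (hf : f ∈ G.neumannDom m)
    (h : G.bdryEnergy m μ β f < ∞) :
    G.bdryBilin m μ β f f = (G.bdryEnergy m μ β f).toReal := by
  simp only [bdryBilin, ← sq]
  rw [integral_eq_lintegral_of_nonneg_ae (Eventually.of_forall fun z => sq_nonneg _)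
    ((measurable_toReal_trace hf).pow_const 2).aestronglyMeasurable,
    lintegral_ofReal_sq_toReal_trace hβ hf h]

theorem bdryBilin_comm (f g : X → ℝ) : G.bdryBilin m μ β f g = G.bdryBilin m μ β g f :=
  integral_congr_ae (Eventually.of_forall fun _ => mul_comm _ _)

theorem toReal_trace_linear (hf : f ∈ G.neumannDom m) (hg : g ∈ G.neumannDom m) (a b : ℝ)
    {z : G.Bdry m} (h : (G.trace m f z).abs ≠ ∞) (h' : (G.trace m g z).abs ≠ ∞) :
    (G.trace m (a • f + b • g) z).toReal =
      a * (G.trace m f z).toReal + b * (G.trace m g z).toReal := by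
  have hlim := ((tendsto_toReal_ext hf h).const_mul a).add ((tendsto_toReal_ext hg h').const_mul b)
  rw [trace, ext_eq_of_tendsto (add_mem_neumannDom (smul_mem_neumannDom hf a)
    (smul_mem_neumannDom hg b)) hlim, EReal.toReal_coe, trace, trace]

theorem bdryBilin_linear (hβ : Measurable β) (hf : f ∈ G.neumannDom m)
    (hg : g ∈ G.neumannDom m) (hh : h ∈ G.neumannDom m) (ef : G.bdryEnergy m μ β f < ∞)
    (eg : G.bdryEnergy m μ β g < ∞) (eh : G.bdryEnergy m μ β h < ∞) (a b : ℝ) :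
    G.bdryBilin m μ β f (a • g + b • h) =
      a * G.bdryBilin m μ β f g + b * G.bdryBilin m μ β f h := by
  have mf := memLp_toReal_trace hβ hf ef
  have ig := (mf.integrable_mul (memLp_toReal_trace hβ hg eg)).const_mul a
  have ih := (mf.integrable_mul (memLp_toReal_trace hβ hh eh)).const_mul b
  simp only [bdryBilin]
  rw [← integral_const_mul, ← integral_const_mul]
  refine (integral_congr_ae ?_).trans (integral_add ig ih)
  filter_upwards [ae_abs_trace_ne_top hβ hg eg, ae_abs_trace_ne_top hβ hh eh] with z h1 h2
  rw [toReal_trace_linear hg hh a b h1 h2]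
  exact (mul_add _ _ _).trans (congrArg₂ _ (mul_left_comm _ _ _) (mul_left_comm _ _ _))

theorem bdryBilin_eq_zero_of_trace_eq_zero (h : ∀ z, G.trace m f z = 0) (g : X → ℝ) :
    G.bdryBilin m μ β f g = 0 := by
  simp [bdryBilin, h]

theorem ae_trace_eq_zero_of_bdryEnergy_lt_top (hβ : Measurable β) (hf : f ∈ G.neumannDom m)
    (h : G.bdryEnergy m μ β f < ∞) : ∀ᵐ z ∂μ, β z = ∞ → G.trace m f z = 0 := by
  filter_upwards [ae_lt_top (((measurable_abs_trace hf).pow_const 2).mul hβ) h.ne] with z hz htop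
  by_contra hne
  have habs : (G.trace m f z).abs ^ 2 ≠ 0 := pow_ne_zero 2 (by rwa [ne_eq, EReal.abs_eq_zero_iff])
  rw [Pi.mul_apply, htop, ENNReal.mul_top habs] at hz
  exact lt_irrefl _ hz

theorem trace_eq_zero_of_mem_bdryF (hβ : Measurable β) (hf : f ∈ G.neumannDom m)
    (h : G.bdryEnergy m μ β f < ∞) {z : G.Bdry m} (hz : z ∈ G.bdryF m μ β) :
    G.trace m f z = 0 := by
  by_contra hne
  refine (hz _ (isOpen_ne_fun (continuous_trace hf) continuous_const) hne).ne' ?_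
  refine measure_mono_null ?_ (ae_iff.1 (ae_trace_eq_zero_of_bdryEnergy_lt_top hβ hf h))
  exact fun w hw himp => hw.2 (himp hw.1)

end BoundaryEnergy

/-! ## Harmonic measures and convergence of traces -/

section HarmonicMeasure

variable {X : Type*} [MeasurableSpace X] {G : WGraph X} {m : Measure X} {μ : Measure (G.Bdry m)}

theorem continuous_trace₀ (f : G.bddDom m) : Continuous (G.trace₀ m f) :=
  (G.continuous_bddExt m f).comp continuous_subtype_val

theorem trace₀_nonneg {f : G.bddDom m} (h : ∀ x, 0 ≤ f.1 x) (z : G.Bdry m) : 0 ≤ G.trace₀ m f z :=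
  ge_of_tendsto' (tendsto_bddExt f z.1) h

theorem abs_trace₀_le {f : G.bddDom m} {K : ℝ} (h : ∀ x, |f.1 x| ≤ K) (z : G.Bdry m) :
    |G.trace₀ m f z| ≤ K :=
  le_of_tendsto' (tendsto_bddExt f z.1).abs h

theorem memLp_trace₀ [IsFiniteMeasure μ] (f : G.bddDom m) (p : ℝ≥0∞) :
    MemLp (G.trace₀ m f) p μ := by
  obtain ⟨K, hK⟩ := f.2.2
  exact .of_bound (continuous_trace₀ f).measurable.aestronglyMeasurable K
    (Eventually.of_forall (abs_trace₀_le hK))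

theorem IsHarmonicMeasure.isFiniteMeasure {o : X} (hμ : G.IsHarmonicMeasure m o μ) :
    IsFiniteMeasure μ :=
  ⟨hμ.mass_le.trans_lt ENNReal.one_lt_top⟩

variable [PosFiniteAtoms m]

/-- The truncated absolute value `min(1, |F|)` of an element of the Neumann space. -/
def truncAbs (F : G.NSpace m) : G.NSpace m :=
  contract (lipschitzWith_clamp 1) (clamp_zero zero_le_one) (absN F)

theorem fn_truncAbs (F : G.NSpace m) (x : X) : G.fn m (truncAbs F) x = min 1 |G.fn m F x| := by
  rw [truncAbs, fn_contract, Function.comp_apply, fn_absN, clamp, max_eq_right]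
  linarith [le_min zero_le_one (abs_nonneg (G.fn m F x))]

theorem norm_truncAbs_le (F : G.NSpace m) : ‖truncAbs F‖ ≤ ‖F‖ :=
  (norm_contract_le _ _ _).trans (norm_absN_le F)

theorem fn_truncAbs_nonneg (F : G.NSpace m) (x : X) : 0 ≤ G.fn m (truncAbs F) x := by
  rw [fn_truncAbs]
  exact le_min zero_le_one (abs_nonneg _)

theorem fn_truncAbs_mem_bddDom (F : G.NSpace m) : G.fn m (truncAbs F) ∈ G.bddDom m := by
  refine ⟨fn_mem _, 1, fun x => ?_⟩
  rw [abs_of_nonneg (fn_truncAbs_nonneg F x), fn_truncAbs]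
  exact min_le_left _ _

theorem ofReal_trace₀_truncAbs (F : G.NSpace m) (z : G.Bdry m) :
    ENNReal.ofReal (G.trace₀ m ⟨_, fn_truncAbs_mem_bddDom F⟩ z) =
      min 1 (G.trace m (G.fn m F) z).abs := by
  refine tendsto_nhds_unique (ENNReal.tendsto_ofReal (tendsto_bddExt _ z.1))
    ((tendsto_const_nhds.min (tendsto_abs_ext (fn_mem F) z.1)).congr fun x => ?_)
  rw [← ENNReal.ofReal_one, ← ENNReal.ofReal_min, ← fn_truncAbs]

variable [MeasurableSingletonClass X]

theorem exists_isHarmonicExt {A : G.NSpace m} (hA : G.fn m A ∈ G.bddDom m) :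
    ∃ P ∈ G.DSpace m, ∃ H ∈ (G.DSpace m)ᗮ, A = P + H ∧ ‖H‖ ≤ ‖A‖ ∧
      G.IsHarmonicExt m (fun z => (G.trace₀ m ⟨_, hA⟩ z : EReal)) (G.fn m H) := by
  obtain ⟨P, hP, H, hH, hPH⟩ := (G.DSpace m).exists_add_mem_mem_orthogonal A
  refine ⟨P, hP, H, hH, hPH, ?_, fn_mem H, lap_add_eq_zero_of_mem_orthogonal hH, funext fun z => ?_⟩
  · refine le_of_sq_le_sq ?_ (norm_nonneg A)
    rw [hPH, norm_add_sq_real, (Submodule.mem_orthogonal _ _).1 hH _ hP]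
    linarith [sq_nonneg ‖P‖]
  · have hlim := (tendsto_bddExt ⟨_, hA⟩ z.1).sub
      (tendsto_zero_of_ext_eq_zero (fn_mem P) (trace_eq_zero_of_mem_DSpace hP z))
    rw [sub_zero] at hlim
    refine ext_eq_of_tendsto (fn_mem H) (hlim.congr fun x => ?_)
    have hx := congrFun (congrArg (G.fn m) hPH) x
    rw [map_add, Pi.add_apply] at hx
    exact sub_eq_of_eq_add' hx

namespace IsHarmonicMeasure

variable {o : X}

theorem lintegral_min_abs_trace_le (hμ : G.IsHarmonicMeasure m o μ) (F : G.NSpace m) :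
    ∫⁻ z, min 1 (G.trace m (G.fn m F) z).abs ∂μ ≤
      ENNReal.ofReal ((√(m.real {o}))⁻¹ * ‖F‖) := by
  have := hμ.isFiniteMeasure
  obtain ⟨-, -, H, -, -, hle, hext⟩ := exists_isHarmonicExt (fn_truncAbs_mem_bddDom F)
  simp only [← ofReal_trace₀_truncAbs]
  rw [← ofReal_integral_eq_lintegral_ofReal (memLp_one_iff_integrable.1 (memLp_trace₀ _ 1))
    (Eventually.of_forall (trace₀_nonneg (fn_truncAbs_nonneg F))), ← hμ.repr _ _ hext]
  refine ENNReal.ofReal_le_ofReal ((le_abs_self _).trans ((abs_fn_apply_le H o).trans ?_))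
  exact mul_le_mul_of_nonneg_left (hle.trans (norm_truncAbs_le F))
    (inv_nonneg.2 (Real.sqrt_nonneg _))

theorem exists_subseq_tendsto_trace (hμ : G.IsHarmonicMeasure m o μ) {U : ℕ → G.NSpace m}
    (hU : Tendsto U atTop (𝓝 0)) : ∃ ns : ℕ → ℕ, StrictMono ns ∧
      ∀ᵐ z ∂μ, Tendsto (fun k => (G.trace m (G.fn m (U (ns k))) z).abs) atTop (𝓝 0) := by
  have hlim : Tendsto (fun k => ENNReal.ofReal ((√(m.real {o}))⁻¹ * ‖U k‖)) atTop (𝓝 0) := by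
    simpa using ENNReal.tendsto_ofReal ((tendsto_norm_zero.comp hU).const_mul (√(m.real {o}))⁻¹)
  obtain ⟨δ, hδ, hδs⟩ := ENNReal.exists_pos_sum_of_countable' one_ne_zero ℕ
  obtain ⟨ns, hns, hlt⟩ := extraction_forall_of_eventually fun k =>
    hlim.eventually (gt_mem_nhds (hδ k))
  refine ⟨ns, hns, ?_⟩
  have hmeas : ∀ k, Measurable fun z => min 1 (G.trace m (G.fn m (U (ns k))) z).abs := fun k =>
    measurable_const.min (measurable_abs_trace (fn_mem _))
  have hsum : ∫⁻ z, ∑' k, min 1 (G.trace m (G.fn m (U (ns k))) z).abs ∂μ ≠ ∞ := by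
    rw [lintegral_tsum fun k => (hmeas k).aemeasurable]
    refine ne_top_of_le_ne_top ENNReal.one_ne_top (hδs.le.trans' (ENNReal.tsum_le_tsum fun k => ?_))
    exact (hμ.lintegral_min_abs_trace_le _).trans (hlt k).le
  filter_upwards [ae_lt_top (Measurable.tsum hmeas) hsum] with z hz
  have hzero := ENNReal.tendsto_atTop_zero_of_tsum_ne_top hz.ne
  refine hzero.congr' ?_
  filter_upwards [hzero.eventually (gt_mem_nhds one_pos)] with k hk
  exact min_eq_right ((min_lt_iff.1 hk).resolve_left (lt_irrefl _)).le

theorem bdryEnergy_le_of_tendsto (hμ : G.IsHarmonicMeasure m o μ) {β : G.Bdry m → ℝ≥0∞}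
    (hβ : Measurable β) {U : ℕ → G.NSpace m} {F : G.NSpace m} (hU : Tendsto U atTop (𝓝 F))
    {C : ℝ≥0∞} (hC : ∀ᶠ n in atTop, G.bdryEnergy m μ β (G.fn m (U n)) ≤ C) :
    G.bdryEnergy m μ β (G.fn m F) ≤ C := by
  have hsub : Tendsto (fun n => F - U n) atTop (𝓝 0) := by
    simpa using (tendsto_const_nhds (x := F)).sub hU
  obtain ⟨ns, hns, hlim⟩ := hμ.exists_subseq_tendsto_trace hsub
  set T : G.NSpace m → G.Bdry m → ℝ≥0∞ := fun E z => (G.trace m (G.fn m E) z).abs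
  have hT : ∀ E, Measurable (T E) := fun E => measurable_abs_trace (fn_mem E)
  have htri : ∀ k z, T F z - T (F - U (ns k)) z ≤ T (U (ns k)) z := fun k z => by
    have hadd := abs_ext_add_le (fn_mem (U (ns k))) (fn_mem (F - U (ns k))) z.1
    rw [← map_add, add_sub_cancel] at hadd
    exact tsub_le_iff_right.2 hadd
  have hle : ∀ᶠ k in atTop, ∫⁻ z, (T F z - T (F - U (ns k)) z) ^ 2 ∂(μ.withDensity β) ≤ C := by
    filter_upwards [hns.tendsto_atTop.eventually hC] with k hk
    rw [bdryEnergy_eq_lintegral_withDensity hβ (fn_mem _)] at hk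
    exact (lintegral_mono fun z => pow_le_pow_left' (htri k z) 2).trans hk
  rw [bdryEnergy_eq_lintegral_withDensity hβ (fn_mem _)]
  calc ∫⁻ z, T F z ^ 2 ∂(μ.withDensity β)
      = ∫⁻ z, liminf (fun k => (T F z - T (F - U (ns k)) z) ^ 2) atTop ∂(μ.withDensity β) := by
        refine lintegral_congr_ae ?_
        filter_upwards [withDensity_absolutelyContinuous μ β hlim] with z hz
        have hpow := ((ENNReal.continuous_pow 2).tendsto _).comp
          (ENNReal.Tendsto.sub (tendsto_const_nhds (x := T F z)) hz (Or.inr ENNReal.zero_ne_top))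
        rw [tsub_zero] at hpow
        exact hpow.liminf_eq.symm
    _ ≤ liminf (fun k => ∫⁻ z, (T F z - T (F - U (ns k)) z) ^ 2 ∂(μ.withDensity β)) atTop :=
        lintegral_liminf_le fun k => ((hT _).sub (hT _)).pow_const 2
    _ ≤ C := liminf_le_of_frequently_le' hle.frequently

end IsHarmonicMeasure

end HarmonicMeasure

end WGraph

/-! ## The Robin forms -/

namespace WGraph

open PosFiniteAtoms

variable {X : Type*} [MeasurableSpace X] {G : WGraph X} {m : Measure X} {μ : Measure (G.Bdry m)}

theorem neumannForm_same_robinForm : (G.neumannForm m).Same (G.robinForm m μ fun _ => 0) := by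
  refine ⟨Set.ext fun f => ?_, fun f _ g _ => ?_⟩
  · simp [neumannForm, robinForm, bdryEnergy]
  · simp [neumannForm, robinForm, bdryBilin, withDensity_const]

variable {β : G.Bdry m → ℝ≥0∞}

theorem robinForm_val_self (hβ : Measurable β) {f : Lp ℝ 2 m}
    (hf : f ∈ (G.robinForm m μ β).dom) : (G.robinForm m μ β).val f f =
      G.energyBilin f f + (G.bdryEnergy m μ β f).toReal :=
  congrArg _ (bdryBilin_self hβ hf.1 hf.2)

variable [PosFiniteAtoms m]

theorem mem_robinDom_iff (hβ : Measurable β) {f : Lp ℝ 2 m} : (f : X → ℝ) ∈ G.robinDom m μ β ↔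
    f ∈ (G.robinForm m μ β).dom ∧ MemLp (G.lap m f) 2 m ∧
      ∀ g ∈ (G.robinForm m μ β).dom, (G.robinForm m μ β).val g f = ∫ x, g x * G.lap m f x ∂m := by
  have key {g : X → ℝ} (hf : (f : X → ℝ) ∈ G.neumannDom m) (hg : g ∈ G.neumannDom m) :
      G.normalFunctional m f g + G.bdryBilin m μ β f g = 0 ↔
        G.energyBilin g f + G.bdryBilin m μ β g f = ∫ x, g x * G.lap m f x ∂m := by
    rw [bdryBilin_comm, (mem_neumannDom.1 hf).2.normalFunctional_add_eq_zero_iff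
      (mem_neumannDom.1 hg).2]
  constructor
  · rintro ⟨hf, hmem, he, -, h⟩
    exact ⟨⟨hf, he⟩, hmem, fun g hg => (key hf hg.1).1
      (h g hg.1 hg.2 fun z hz => trace_eq_zero_of_mem_bdryF hβ hg.1 hg.2 hz)⟩
  · rintro ⟨⟨hf, he⟩, hmem, h⟩
    have h' := (forall_coe_iff (P := fun g => g ∈ G.neumannDom m ∧ G.bdryEnergy m μ β g < ∞ →
      G.energyBilin g f + G.bdryBilin m μ β g f = ∫ x, g x * G.lap m f x ∂m)).1 h
    exact ⟨hf, hmem, he, fun z hz => trace_eq_zero_of_mem_bdryF hβ hf he hz,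
      fun g hg hge _ => (key hf hg).2 (h' g hg.1 ⟨hg, hge⟩)⟩

theorem continuous_energyBilin_self :
    Continuous fun F : G.NSpace m => G.energyBilin (G.fn m F) (G.fn m F) := by
  have h : (fun F : G.NSpace m => G.energyBilin (G.fn m F) (G.fn m F)) =
      fun F => ‖F‖ ^ 2 - ‖G.toL2 m F‖ ^ 2 :=
    funext fun F => eq_sub_of_add_eq (NSpace.norm_sq_eq F).symm
  rw [h]
  exact (continuous_norm.pow 2).sub
    ((G.neumannForm_isForm m).lipschitzWith_toH.continuous.norm.pow 2)

variable [MeasurableSingletonClass X]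

theorem robinForm_isForm (hβ : Measurable β) : (G.robinForm m μ β).IsForm where
  zero_mem := by
    refine ⟨(G.neumannForm_isForm m).zero_mem, ?_⟩
    rw [coe_zero, bdryEnergy_eq_zero_of_trace_eq_zero fun z => ?_]
    · exact ENNReal.zero_lt_top
    · simpa using trace_eq_zero_of_mem_DSpace (G.DSpace m).zero_mem z
  add_mem f hf g hg := by
    refine ⟨(G.neumannForm_isForm m).add_mem f hf.1 g hg.1, ?_⟩
    rw [coe_add]
    exact bdryEnergy_add_lt_top hβ hf.1 hg.1 hf.2 hg.2
  smul_mem a f hf := by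
    refine ⟨(G.neumannForm_isForm m).smul_mem a f hf.1, ?_⟩
    rw [coe_smul, bdryEnergy_smul hf.1]
    exact ENNReal.mul_lt_top (ENNReal.pow_lt_top ENNReal.ofReal_lt_top) hf.2
  symm f hf g hg := congrArg₂ (· + ·) ((G.neumannForm_isForm m).symm f hf.1 g hg.1)
    (bdryBilin_comm _ _)
  linear f hf g hg h hh a b := by
    have henergy : G.energyBilin f (a • g + b • h : Lp ℝ 2 m) =
        a * G.energyBilin f g + b * G.energyBilin f h :=
      (G.neumannForm_isForm m).linear f hf.1 g hg.1 h hh.1 a b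
    have hbdry := bdryBilin_linear hβ hf.1 hg.1 hh.1 hf.2 hg.2 hh.2 a b
    rw [← coe_smul, ← coe_smul, ← coe_add] at hbdry
    simp only [robinForm]
    rw [henergy, hbdry]
    ring
  nonneg f hf := add_nonneg ((G.neumannForm_isForm m).nonneg f hf.1) <| by
    rw [bdryBilin_self hβ hf.1 hf.2]
    exact ENNReal.toReal_nonneg

theorem delta_mem_robinForm (x : X) : delta m x ∈ (G.robinForm m μ β).dom :=
  ⟨G.delta_mem_neumannForm m x, (bdryEnergy_eq_zero_of_trace_eq_zero
    (trace_eq_zero_of_mem_DSpace (G.deltaN_mem_DSpace m x))).trans_lt ENNReal.zero_lt_top⟩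

theorem robinForm_val_delta {f : Lp ℝ 2 m} (hf : f ∈ (G.robinForm m μ β).dom) (x : X) :
    (G.robinForm m μ β).val (delta m x) f = m.real {x} * G.lap m f x := by
  have hbdry : G.bdryBilin m μ β (delta m x) f = 0 :=
    bdryBilin_eq_zero_of_trace_eq_zero (trace_eq_zero_of_mem_DSpace (G.deltaN_mem_DSpace m x)) _
  simp only [robinForm]
  rw [hbdry, add_zero]
  exact (mem_neumannDom.1 hf.1).2.energyBilin_delta x

namespace IsHarmonicMeasure

variable {o : X}

theorem robinForm_closed (hμ : G.IsHarmonicMeasure m o μ) (hβ : Measurable β) :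
    (G.robinForm m μ β).Closed := by
  have hN := G.neumannForm_isForm m
  have hQ := robinForm_isForm (G := G) (m := m) (μ := μ) hβ
  refine hQ.closed_of_val_le_of_tendsto fun u f C hu hf hC => ?_
  have hdom : (G.robinForm m μ β).dom ⊆ (G.neumannForm m).dom := fun _ hg => hg.1
  have hlip := hQ.lipschitzWith_inclusion hN hdom fun g hg => by
    rw [robinForm_val_self hβ hg]
    exact le_add_of_nonneg_right ENNReal.toReal_nonneg
  obtain ⟨F, hF⟩ := cauchySeq_tendsto_of_complete (hlip.uniformContinuous.comp_cauchySeq hu)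
  obtain rfl : G.toL2 m F = f :=
    tendsto_nhds_unique ((hN.lipschitzWith_toH.continuous.tendsto F).comp hF) hf
  have henergy := (continuous_energyBilin_self.tendsto F).comp hF
  have hEle : G.energyBilin (G.fn m F) (G.fn m F) ≤ C := le_of_tendsto henergy <| by
    filter_upwards [hC] with n hn
    rw [robinForm_val_self hβ (hQ.toH_mem _)] at hn
    exact (le_add_of_nonneg_right ENNReal.toReal_nonneg).trans hn
  have hbdry : ∀ ε > 0, G.bdryEnergy m μ β (G.fn m F) ≤
      ENNReal.ofReal (C - G.energyBilin (G.fn m F) (G.fn m F) + ε) := fun ε hε => by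
    refine hμ.bdryEnergy_le_of_tendsto hβ hF ?_
    filter_upwards [hC, henergy.eventually (lt_mem_nhds (sub_lt_self _ hε))] with n hn
      (hlt : _ < G.energyBilin (hQ.toH (u n)) (hQ.toH (u n)))
    rw [robinForm_val_self hβ (hQ.toH_mem _)] at hn
    refine (ENNReal.le_ofReal_iff_toReal_le (hQ.toH_mem (u n)).2.ne (by linarith)).2 ?_
    exact (le_sub_iff_add_le'.2 hn).trans (by linarith)
  have hmem : G.toL2 m F ∈ (G.robinForm m μ β).dom :=
    ⟨fn_mem F, (hbdry 1 one_pos).trans_lt ENNReal.ofReal_lt_top⟩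
  refine ⟨hmem, le_of_forall_pos_le_add fun ε hε => ?_⟩
  rw [robinForm_val_self hβ hmem, ← fn_eq_coe]
  linarith [ENNReal.toReal_le_of_le_ofReal (by linarith) (hbdry ε hε)]

theorem robinForm_isDirichletForm (hμ : G.IsHarmonicMeasure m o μ) (hβ : Measurable β) :
    (G.robinForm m μ β).IsDirichletForm where
  isForm := robinForm_isForm hβ
  closed := hμ.robinForm_closed hβ
  dense := dense_dom_of_delta_mem (robinForm_isForm hβ) delta_mem_robinForm
  markov C hC hC0 f hf := by
    have hdom := comp_mem_neumannDom hf.1 hC hC0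
    have hle : G.bdryEnergy m μ β (C ∘ f) ≤ G.bdryEnergy m μ β f :=
      bdryEnergy_le_of_abs_le hdom hf.1 fun x => by
        simpa [Real.dist_eq, hC0] using hC.dist_le_mul (f x) 0
    rw [← coe_compLp hC hC0 f] at hdom hle
    have hmem : hC.compLp hC0 f ∈ (G.robinForm m μ β).dom := ⟨hdom, hle.trans_lt hf.2⟩
    refine ⟨hmem, ?_⟩
    rw [robinForm_val_self hβ hmem, robinForm_val_self hβ hf]
    refine add_le_add ?_ (ENNReal.toReal_mono hf.2.ne hle)
    rw [coe_compLp]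
    exact (mem_neumannDom.1 hf.1).2.energyBilin_comp_le hC hC0

theorem exists_robinLaplacian (hμ : G.IsHarmonicMeasure m o μ) (hβ : Measurable β) :
    ∃ L : Lp ℝ 2 m →ₗ.[ℝ] Lp ℝ 2 m, HForm.IsOperatorOf L (G.robinForm m μ β) ∧
      G.IsLapRestriction m L (G.robinDom m μ β) :=
  exists_lapRestriction (robinForm_isForm hβ) (hμ.robinForm_closed hβ) delta_mem_robinForm
    (fun x _ hf => robinForm_val_delta hf x) fun _ => mem_robinDom_iff hβ

theorem mem_DSpace_of_ae_trace_eq_zero (hμ : G.IsHarmonicMeasure m o μ) (hG : G.Connected)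
    {A : G.NSpace m} (hA : G.fn m A ∈ G.bddDom m) (h0 : ∀ x, 0 ≤ G.fn m A x)
    (h : ∀ᵐ z ∂μ, G.trace m (G.fn m A) z = 0) : A ∈ G.DSpace m := by
  obtain ⟨P, hP, H, hH, rfl, -, hext⟩ := exists_isHarmonicExt hA
  have hHo : G.fn m H o = 0 := by
    rw [hμ.repr _ _ hext]
    refine integral_eq_zero_of_ae (h.mono fun z hz => EReal.coe_eq_zero.1 (Eq.trans ?_ hz))
    exact (G.trace_eq_trace₀ m ⟨_, hA⟩ z).symm
  have hH0 : G.fn m H = 0 := eq_zero_of_connected hG (fn_finEnergy H)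
    (fn_nonneg_of_mem_orthogonal hP hH h0) hext.2.1 hHo
  rwa [fn_injective (hH0.trans (map_zero _).symm), add_zero]

theorem mem_dirichletDom_of_ae_trace_eq_zero (hμ : G.IsHarmonicMeasure m o μ) (hG : G.Connected)
    {f : X → ℝ} (hf : f ∈ G.neumannDom m) (h : ∀ᵐ z ∂μ, G.trace m f z = 0) :
    f ∈ G.dirichletDom m := by
  set A : G.NSpace m := absN (contract lipschitzWith_arctan Real.arctan_zero (toN hf)) with hAf
  have hA (x : X) : G.fn m A x = |Real.arctan (f x)| := by
    simp only [hAf, fn_absN, fn_contract, fn_toN, Function.comp_apply]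
  have hAle (x : X) : |G.fn m A x| ≤ |f x| := by
    simpa [hA, Real.dist_eq] using lipschitzWith_arctan.dist_le_mul (f x) 0
  have hAbdd : G.fn m A ∈ G.bddDom m := ⟨fn_mem A, Real.pi / 2, fun x => by
    rw [hA, abs_abs]
    exact abs_le.2 ⟨(Real.neg_pi_div_two_lt_arctan _).le, (Real.arctan_lt_pi_div_two _).le⟩⟩
  have hAD : A ∈ G.DSpace m := by
    refine hμ.mem_DSpace_of_ae_trace_eq_zero hG hAbdd (fun x => hA x ▸ abs_nonneg _) ?_
    filter_upwards [h] with z hz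
    have hle : (G.trace m (G.fn m A) z).abs ≤ (G.trace m f z).abs :=
      abs_ext_le_of_abs_le (fn_mem A) hf hAle z.1
    rwa [EReal.abs_eq_zero_iff.2 hz, nonpos_iff_eq_zero, EReal.abs_eq_zero_iff] at hle
  refine mem_dirichletDom_iff_trace.2 ⟨hf, fun z => ext_eq_zero_of_tendsto_arctan hf ?_⟩
  exact (tendsto_zero_iff_abs_tendsto_zero _).2
    ((tendsto_zero_of_ext_eq_zero (fn_mem A) (trace_eq_zero_of_mem_DSpace hAD z)).congr hA)

theorem dirichletForm_same_robinForm (hμ : G.IsHarmonicMeasure m o μ) (hG : G.Connected) :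
    (G.dirichletForm m).Same (G.robinForm m μ fun _ => ∞) := by
  refine ⟨Set.ext fun f => ⟨fun hf => ⟨hf.1, ?_⟩, fun hf => ?_⟩, fun f hf g _ => ?_⟩
  · rw [bdryEnergy_eq_zero_of_trace_eq_zero (mem_dirichletDom_iff_trace.1 hf).2]
    exact ENNReal.zero_lt_top
  · refine hμ.mem_dirichletDom_of_ae_trace_eq_zero hG hf.1 ?_
    filter_upwards [ae_trace_eq_zero_of_bdryEnergy_lt_top measurable_const hf.1 hf.2] with z hz
    exact hz rfl
  · simp only [dirichletForm, robinForm]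
    rw [bdryBilin_eq_zero_of_trace_eq_zero (mem_dirichletDom_iff_trace.1 hf).2, add_zero]

end IsHarmonicMeasure

end WGraph

/-! ## The kernel of the normal derivative -/

theorem measure_inter_eq_zero_of_locally {Y : Type*} [TopologicalSpace Y] [T2Space Y]
    [MeasurableSpace Y] [OpensMeasurableSpace Y] {ν : Measure Y} [IsFiniteMeasure ν] [ν.Regular]
    {N U : Set Y} (hU : IsOpen U) (h : ∀ z ∈ U, ∃ V ∈ 𝓝 z, ν (N ∩ V) = 0) : ν (N ∩ U) = 0 := by
  have hcpt : ∀ K ⊆ U, IsCompact K → ν (N ∩ K) = 0 := fun K hKU hK => by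
    refine hK.induction_on (p := fun s => ν (N ∩ s) = 0) (by simp)
      (fun s t hst ht => measure_mono_null (inter_subset_inter_right _ hst) ht)
      (fun s t hs ht => ?_) (fun z hz => ?_)
    · rw [inter_union_distrib_left]
      exact measure_union_null hs ht
    · obtain ⟨V, hV, hNV⟩ := h z (hKU hz)
      exact ⟨V, mem_nhdsWithin_of_mem_nhds hV, hNV⟩
  refine le_antisymm (le_of_forall_gt_imp_ge_of_dense fun ε hε => ?_) zero_le
  obtain ⟨K, hKU, hK, hlt⟩ := hU.measurableSet.exists_isCompact_sdiff_lt
    (measure_ne_top ν U) hε.ne'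
  calc ν (N ∩ U) ≤ ν (N ∩ K ∪ U \ K) := measure_mono fun z hz => by
        by_cases hzK : z ∈ K
        · exact Or.inl ⟨hz.1, hzK⟩
        · exact Or.inr ⟨hz.2, hzK⟩
    _ ≤ ν (N ∩ K) + ν (U \ K) := measure_union_le _ _
    _ ≤ ε := by rw [hcpt K hKU hK, zero_add]; exact hlt.le

namespace WGraph

open PosFiniteAtoms

variable {X : Type*} [MeasurableSpace X] {G : WGraph X} {m : Measure X} {μ : Measure (G.Bdry m)}

section TraceAlgebra

instance : T2Space (G.Bdry m) :=
  inferInstanceAs (T2Space {p : G.Hat m // p ∉ range (G.incl m) ∧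
    ∀ f : G.bddDom m, (f : X → ℝ) ∈ G.dirichletDom m → G.bddExt m f p = 0})

theorem trace₀_eq_of_tendsto (f : G.bddDom m) (z : G.Bdry m) {a : ℝ}
    (h : Tendsto (f : X → ℝ) (G.nhdsIn m z.1) (𝓝 a)) : G.trace₀ m f z = a :=
  tendsto_nhds_unique (tendsto_bddExt f z.1) h

theorem trace₀_add (f g : G.bddDom m) (z : G.Bdry m) :
    G.trace₀ m ⟨f + g, add_mem_bddDom f.2 g.2⟩ z = G.trace₀ m f z + G.trace₀ m g z :=
  trace₀_eq_of_tendsto _ z ((tendsto_bddExt f z.1).add (tendsto_bddExt g z.1))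

theorem trace₀_smul (a : ℝ) (f : G.bddDom m) (z : G.Bdry m) :
    G.trace₀ m ⟨a • f, smul_mem_bddDom f.2 a⟩ z = a * G.trace₀ m f z :=
  trace₀_eq_of_tendsto _ z ((tendsto_bddExt f z.1).const_mul a)

theorem trace₀_mul (f g : G.bddDom m) (z : G.Bdry m) :
    G.trace₀ m ⟨f * g, mul_mem_bddDom f.2 g.2⟩ z = G.trace₀ m f z * G.trace₀ m g z :=
  trace₀_eq_of_tendsto _ z ((tendsto_bddExt f z.1).mul (tendsto_bddExt g z.1))

theorem isOpen_trace₀_ne_zero (f : G.bddDom m) : IsOpen {z | G.trace₀ m f z ≠ 0} :=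
  isOpen_ne_fun (continuous_trace₀ f) continuous_const

variable [PosFiniteAtoms m]

theorem zero_mem_bddDom : (0 : X → ℝ) ∈ G.bddDom m := by
  refine ⟨?_, 0, by simp⟩
  simpa only [map_zero] using fn_mem (0 : G.NSpace m)

variable (G m) in
/-- The unital algebra of continuous functions on the boundary generated by the traces of the
bounded functions of finite energy. These traces already form an algebra, so adding the constants
suffices. -/
def traceAlgebra : Subalgebra ℝ C(G.Bdry m, ℝ) where
  carrier := {F | ∃ (f : G.bddDom m) (c : ℝ), ∀ z, F z = G.trace₀ m f z + c}
  mul_mem' := by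
    rintro F F' ⟨f, c, hf⟩ ⟨g, d, hg⟩
    refine ⟨⟨_, add_mem_bddDom (mul_mem_bddDom f.2 g.2) (add_mem_bddDom (smul_mem_bddDom f.2 d)
      (smul_mem_bddDom g.2 c))⟩, c * d, fun z => ?_⟩
    rw [trace₀_add ⟨_, mul_mem_bddDom f.2 g.2⟩ ⟨_, add_mem_bddDom (smul_mem_bddDom f.2 d)
      (smul_mem_bddDom g.2 c)⟩, trace₀_mul, trace₀_add ⟨_, smul_mem_bddDom f.2 d⟩
      ⟨_, smul_mem_bddDom g.2 c⟩, trace₀_smul, trace₀_smul, ContinuousMap.mul_apply, hf, hg]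
    ring
  add_mem' := by
    rintro F F' ⟨f, c, hf⟩ ⟨g, d, hg⟩
    refine ⟨⟨_, add_mem_bddDom f.2 g.2⟩, c + d, fun z => ?_⟩
    rw [trace₀_add, ContinuousMap.add_apply, hf, hg]
    ring
  algebraMap_mem' r := ⟨⟨0, zero_mem_bddDom⟩, r, fun z => by
    rw [trace₀_eq_of_tendsto ⟨0, zero_mem_bddDom⟩ z (a := 0) tendsto_const_nhds]
    simp⟩

variable [MeasurableSingletonClass X]

theorem isOpen_singleton_incl_of_posFiniteAtoms (x : X) : IsOpen {G.incl m x} := by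
  classical
  set e := G.bddExt m ⟨_, fn_deltaN_mem_bddDom x⟩
  have hincl : ∀ y, e (G.incl m y) = Pi.single (M := fun _ => ℝ) x 1 y := fun y =>
    congrFun (fn_deltaN x) y
  have hopen : IsOpen {p | 1 / 2 < e p} := isOpen_Ioi.preimage (G.continuous_bddExt m _)
  convert hopen
  refine Subset.antisymm ?_ (((G.denseRange_incl m).open_subset_closure_inter hopen).trans
    (closure_minimal ?_ isClosed_singleton))
  · rintro _ rfl
    rw [mem_ofPred_eq, hincl, Pi.single_eq_same]
    norm_num
  · rintro _ ⟨hp, y, rfl⟩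
    by_contra hne
    rw [mem_ofPred_eq, hincl, Pi.single_eq_of_ne fun h => hne (congrArg _ h)] at hp
    norm_num at hp

instance : CompactSpace (G.Bdry m) := by
  refine isCompact_iff_compactSpace.mp (IsClosed.isCompact ?_)
  refine IsClosed.inter (s₁ := {p | p ∉ range (G.incl m)}) ?_ ?_
  · rw [← isOpen_compl_iff]
    have hrange : {p | p ∉ range (G.incl m)}ᶜ = ⋃ x, {G.incl m x} := by
      ext p
      simp [eq_comm]
    rw [hrange]
    exact isOpen_iUnion isOpen_singleton_incl_of_posFiniteAtoms
  · change IsClosed {p | ∀ f : G.bddDom m, (f : X → ℝ) ∈ G.dirichletDom m → G.bddExt m f p = 0}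
    simp only [ofPred_forall]
    exact isClosed_iInter fun f => isClosed_iInter fun _ =>
      isClosed_eq (G.continuous_bddExt m f) continuous_const

theorem dense_traceAlgebra : Dense (G.traceAlgebra m : Set C(G.Bdry m, ℝ)) := by
  have htop : (G.traceAlgebra m).topologicalClosure = ⊤ := by
    refine ContinuousMap.subalgebra_topologicalClosure_eq_top_of_separatesPoints _ fun z w hzw => ?_
    obtain ⟨f, hf⟩ : ∃ f : G.bddDom m, G.trace₀ m f z ≠ G.trace₀ m f w := by
      by_contra! hcon
      exact hzw (Subtype.ext (G.bddExt_separates m hcon))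
    exact ⟨_, ⟨⟨G.trace₀ m f, continuous_trace₀ f⟩, ⟨f, 0, fun z => (add_zero _).symm⟩, rfl⟩, hf⟩
  rw [dense_iff_closure_eq, ← Subalgebra.topologicalClosure_coe, htop, Algebra.coe_top]

end TraceAlgebra

section Orthogonality

theorem memLp_mul_trace₀ (φ : Lp ℝ 2 μ) (f : G.bddDom m) :
    MemLp (fun z => φ z * G.trace₀ m f z) 2 μ := by
  obtain ⟨K, hK⟩ := f.2.2
  refine ((Lp.memLp φ).const_mul K).of_le ((Lp.memLp φ).1.mul
    (continuous_trace₀ f).measurable.aestronglyMeasurable) (Eventually.of_forall fun z => ?_)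
  rw [norm_mul, norm_mul, mul_comm, Real.norm_eq_abs, Real.norm_eq_abs K]
  exact mul_le_mul_of_nonneg_right ((abs_trace₀_le hK z).trans (le_abs_self K)) (norm_nonneg _)

theorem integral_mul_mul_trace₀_eq_zero [PosFiniteAtoms m] [MeasurableSingletonClass X]
    [IsFiniteMeasure μ] {φ : Lp ℝ 2 μ} (h : ∀ f : G.bddDom m, ∫ z, φ z * G.trace₀ m f z ∂μ = 0)
    (f : G.bddDom m) {F : C(G.Bdry m, ℝ)} (hF : F ∈ G.traceAlgebra m) :
    ∫ z, F z * (φ z * G.trace₀ m f z) ∂μ = 0 := by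
  obtain ⟨g, c, hg⟩ := hF
  have hexpand : ∀ z, F z * (φ z * G.trace₀ m f z) =
      φ z * G.trace₀ m ⟨f * g, mul_mem_bddDom f.2 g.2⟩ z + c * (φ z * G.trace₀ m f z) := fun z => by
    rw [hg, trace₀_mul]
    ring
  simp only [hexpand]
  rw [integral_add ((memLp_mul_trace₀ φ _).integrable one_le_two)
    (((memLp_mul_trace₀ φ f).integrable one_le_two).const_mul c), integral_const_mul, h, h,
    mul_zero, add_zero]

theorem ae_mul_trace₀_eq_zero [PosFiniteAtoms m] [MeasurableSingletonClass X] [IsFiniteMeasure μ]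
    [μ.WeaklyRegular] {φ : Lp ℝ 2 μ} (h : ∀ f : G.bddDom m, ∫ z, φ z * G.trace₀ m f z ∂μ = 0)
    (f : G.bddDom m) :
    ∀ᵐ z ∂μ, φ z * G.trace₀ m f z = 0 := by
  have hdense : Dense (ContinuousMap.toLp 2 μ ℝ '' (G.traceAlgebra m : Set C(G.Bdry m, ℝ))) :=
    (ContinuousMap.toLp_denseRange ℝ μ ℝ (p := 2) (by simp)).dense_image
      (ContinuousMap.toLp 2 μ ℝ).continuous dense_traceAlgebra
  have hmem := memLp_mul_trace₀ φ f
  refine (hmem.toLp_eq_toLp_iff MemLp.zero).1 (Eq.trans ?_ (MemLp.toLp_zero _).symm)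
  refine hdense.eq_zero_of_inner_right ℝ ?_
  rintro _ ⟨F, hF, rfl⟩
  rw [L2.inner_def, ← integral_mul_mul_trace₀_eq_zero h f hF]
  refine integral_congr_ae ?_
  filter_upwards [ContinuousMap.coeFn_toLp (p := 2) (𝕜 := ℝ) μ F, hmem.coeFn_toLp] with z hFz hz
  rw [hFz, hz, RCLike.inner_apply, conj_trivial, mul_comm]

theorem ae_eq_zero_of_trace₀_ne_zero [IsFiniteMeasure μ] [μ.Regular] {φ : G.Bdry m → ℝ}
    (h : ∀ f : G.bddDom m, ∀ᵐ z ∂μ, φ z * G.trace₀ m f z = 0) :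
    ∀ᵐ z ∂μ, (∃ f : G.bddDom m, G.trace₀ m f z ≠ 0) → φ z = 0 := by
  have hopen : IsOpen {z | ∃ f : G.bddDom m, G.trace₀ m f z ≠ 0} := by
    rw [ofPred_exists]
    exact isOpen_iUnion isOpen_trace₀_ne_zero
  refine ae_iff.2 (measure_mono_null (fun z hz => ?_)
    (measure_inter_eq_zero_of_locally (N := {z | φ z ≠ 0}) hopen ?_))
  · rwa [mem_ofPred_eq, Classical.not_imp, and_comm] at hz
  · rintro z ⟨f, hf⟩
    refine ⟨_, (isOpen_trace₀_ne_zero f).mem_nhds hf, measure_mono_null ?_ (ae_iff.1 (h f))⟩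
    exact fun w hw => mul_ne_zero hw.1 hw.2

theorem IsHarmonicMeasure.ae_exists_trace₀_ne_zero {o : X} (hμ : G.IsHarmonicMeasure m o μ) :
    ∀ᵐ z ∂μ, ∃ f : G.bddDom m, G.trace₀ m f z ≠ 0 := by
  by_cases h1 : (fun _ => (1 : ℝ)) ∈ G.neumannDom m
  · refine Eventually.of_forall fun z => ⟨⟨_, h1, 1, by simp⟩, ?_⟩
    rw [trace₀_eq_of_tendsto _ z (a := 1) tendsto_const_nhds]
    exact one_ne_zero
  · by_contra hne
    obtain ⟨z, hz⟩ := nonempty_of_measure_ne_zero (ae_iff.not.1 hne)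
    simp only [not_exists, not_not, mem_ofPred_eq] at hz
    refine hne (ae_iff.2 (measure_mono_null (fun w hw => ?_) (hμ.infty h1 z hz)))
    simp only [not_exists, not_not, mem_ofPred_eq] at hw
    exact Subtype.ext (G.bddExt_separates m fun f => (hw f).trans (hz f).symm)

theorem IsHarmonicMeasure.eq_zero_of_orthogonal [PosFiniteAtoms m] [MeasurableSingletonClass X]
    {o : X} (hμ : G.IsHarmonicMeasure m o μ) {φ : Lp ℝ 2 μ}
    (h : ∀ f : G.bddDom m, ∫ z, φ z * G.trace₀ m f z ∂μ = 0) : φ = 0 := by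
  have := hμ.isFiniteMeasure
  have := hμ.regular
  refine Lp.eq_zero_iff_ae_eq_zero.2 ?_
  filter_upwards [ae_eq_zero_of_trace₀_ne_zero (ae_mul_trace₀_eq_zero h),
    hμ.ae_exists_trace₀_ne_zero] with z hz hz' using hz hz'

end Orthogonality

theorem IsHarmonicMeasure.normalDerivKer_eq [PosFiniteAtoms m] [MeasurableSingletonClass X]
    {o : X} (hμ : G.IsHarmonicMeasure m o μ) :
    {f | f ∈ G.neumannDom m ∧ MemLp (G.lap m f) 2 m ∧
      ∀ g ∈ G.neumannDom m, G.normalFunctional m f g = 0} = G.normalDerivKer m μ := by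
  have hzero : ∀ g : X → ℝ, ∫ z, (0 : Lp ℝ 2 μ) z * (G.trace m g z).toReal ∂μ = 0 := fun g => by
    refine integral_eq_zero_of_ae ?_
    filter_upwards [Lp.coeFn_zero ℝ 2 μ] with z hz
    rw [hz]
    simp
  ext f
  constructor
  · rintro ⟨hf, hLf, h⟩
    have hdom : f ∈ G.normalDerivDom m μ := ⟨hf, hLf, 0, fun g hg => by rw [hzero, h g hg]⟩
    refine ⟨hdom, ?_⟩
    rw [normalDeriv, dif_pos hdom]
    refine hμ.eq_zero_of_orthogonal fun g => ?_
    rw [← h g g.2.1, ← hdom.2.2.choose_spec g g.2.1]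
    simp only [trace_eq_trace₀, EReal.toReal_coe]
  · rintro ⟨hdom, hker⟩
    refine ⟨hdom.1, hdom.2.1, fun g hg => ?_⟩
    rw [normalDeriv, dif_pos hdom] at hker
    rw [← hdom.2.2.choose_spec g hg, hker, hzero]

end WGraph

end

theorem mainTheorem4_general {X : Type*} [MeasurableSpace X] [MeasurableSingletonClass X]
    (m : Measure X) (hm : ∀ x, 0 < m {x} ∧ m {x} < ∞) (G : WGraph X) :
    (∀ (o : X) (μ : Measure (G.Bdry m)), G.IsHarmonicMeasure m o μ →
      (∀ β : G.Bdry m → ℝ≥0∞, Measurable β →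
        (G.robinForm m μ β).IsDirichletForm ∧
          ∃ L : Lp ℝ 2 m →ₗ.[ℝ] Lp ℝ 2 m, HForm.IsOperatorOf L (G.robinForm m μ β) ∧
            G.IsLapRestriction m L (G.robinDom m μ β)) ∧
      (G.Connected → (G.dirichletForm m).Same (G.robinForm m μ (fun _ => ∞))) ∧
      (G.neumannForm m).Same (G.robinForm m μ (fun _ => 0)) ∧
      {f | f ∈ G.neumannDom m ∧ MemLp (G.lap m f) 2 m ∧
        ∀ g ∈ G.neumannDom m, G.normalFunctional m f g = 0} = G.normalDerivKer m μ) ∧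
    (∃ L : Lp ℝ 2 m →ₗ.[ℝ] Lp ℝ 2 m, HForm.IsOperatorOf L (G.dirichletForm m) ∧
      G.IsLapRestriction m L {f | f ∈ G.neumannDom m ∧ MemLp (G.lap m f) 2 m ∧
        ∀ z, G.trace m f z = 0}) ∧
    (∃ L : Lp ℝ 2 m →ₗ.[ℝ] Lp ℝ 2 m, HForm.IsOperatorOf L (G.neumannForm m) ∧
      G.IsLapRestriction m L {f | f ∈ G.neumannDom m ∧ MemLp (G.lap m f) 2 m ∧
        ∀ g ∈ G.neumannDom m, G.normalFunctional m f g = 0}) := by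
  have : PosFiniteAtoms m := ⟨fun x => (hm x).1, fun x => (hm x).2⟩
  refine ⟨fun o μ hμ => ⟨fun β hβ => ?_, ?_, ?_, ?_⟩, ?_, ?_⟩
  · exact ⟨hμ.robinForm_isDirichletForm hβ, hμ.exists_robinLaplacian hβ⟩
  · exact hμ.dirichletForm_same_robinForm
  · exact WGraph.neumannForm_same_robinForm
  · exact hμ.normalDerivKer_eq
  · exact WGraph.exists_dirichletLaplacian
  · exact WGraph.exists_neumannLaplacian

theorem mainTheorem4 {X : Type*} [Countable X] [MeasurableSpace X] [DiscreteMeasurableSpace X]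
    (m : Measure X) (hm : ∀ x, 0 < m {x} ∧ m {x} < ∞) (G : WGraph X) :
    (∀ (o : X) (μ : Measure (G.Bdry m)), G.IsHarmonicMeasure m o μ →
      (∀ β : G.Bdry m → ℝ≥0∞, Measurable β →
        (G.robinForm m μ β).IsDirichletForm ∧
          ∃ L : Lp ℝ 2 m →ₗ.[ℝ] Lp ℝ 2 m, HForm.IsOperatorOf L (G.robinForm m μ β) ∧
            G.IsLapRestriction m L (G.robinDom m μ β)) ∧
      (G.Connected → (G.dirichletForm m).Same (G.robinForm m μ (fun _ => ∞))) ∧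
      (G.neumannForm m).Same (G.robinForm m μ (fun _ => 0)) ∧
      {f | f ∈ G.neumannDom m ∧ MemLp (G.lap m f) 2 m ∧
        ∀ g ∈ G.neumannDom m, G.normalFunctional m f g = 0} = G.normalDerivKer m μ) ∧
    (∃ L : Lp ℝ 2 m →ₗ.[ℝ] Lp ℝ 2 m, HForm.IsOperatorOf L (G.dirichletForm m) ∧
      G.IsLapRestriction m L {f | f ∈ G.neumannDom m ∧ MemLp (G.lap m f) 2 m ∧
        ∀ z, G.trace m f z = 0}) ∧
    (∃ L : Lp ℝ 2 m →ₗ.[ℝ] Lp ℝ 2 m, HForm.IsOperatorOf L (G.neumannForm m) ∧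
      G.IsLapRestriction m L {f | f ∈ G.neumannDom m ∧ MemLp (G.lap m f) 2 m ∧
        ∀ g ∈ G.neumannDom m, G.normalFunctional m f g = 0}) :=
  mainTheorem4_general m hm G
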